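/- **Setting.** Let $d\in\mathbb N$, $\lambda\in\mathbb R$ and let $W:\mathbb R^d\times\mathbb R\to\mathbb R$ be continuous. Let $\mathcal X$ be the space of continuous $x:\mathbb R^2\to\mathbb R^d$, $(s,t)\mapsto x_{st}$, with $x_{tt}=0$ and $x_{su}+x_{ut}=x_{st}$ for all $s,t,u\in\mathbb R$, with the topology of locally uniform convergence and its Borel $\sigma$-field. Let $\mu$ be the law on $\mathcal X$ of the increments $X_{st}=B_t-B_s$ of a two-sided $d$-dimensional Brownian motion $B$. For $I\subseteq\mathbb R$ let $\mathcal F_I=\sigma(X_{st}:[s,t]\subseteq I)$. For $I=[a,b]$ with $a<b$ put $I^-=(-\infty,a)$, $I^+=(b,\infty)$, $I^c=I^-\cup I^+$. For $x,y\in\mathcal X$ let $x\otimes_I y\in\mathcal X$ be the unique path which agrees with $x$ on $I\times I$ and with $y$ on $I^-\times I^-$ and on $I^+\times I^+$. Let $J(I)=(I^+\times I^-)\cup(I^-\times I^+)\cup(I\times I^c)\cup(I^c\times I)$ and $$U_I(x)=\int_{I\times I}W(x_{st},t-s)\,ds\,dt,$$ $$V_I(x,y)=\int_{J(I)}\big[W((x\otimes_I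 y)_{st},t-s)-W((0\otimes_I y)_{st},t-s)\big]\,ds\,dt .$$ The specification $\Pi$ is the family of kernels $\pi_I(\cdot|y)$, where $\pi_I(\cdot|y)$ is the law of $x\otimes_I y$ when $x$ has the law $Z_I(y)^{-1}e^{-\lambda U_I(x)-\lambda V_I(x,y)}\mu(dx)$. A probability measure $\nu$ on $\mathcal X$ is a Gibbs measure for $\Pi$ if $\pi_I(A|\cdot)=\nu(A|\mathcal F_{I^c})$ $\nu$-a.s. for all such $I$ and all Borel $A\subseteq\mathcal X$. For $T>0$ let $$H_T(x)=\int_{-T}^T\!dt\int_{-T}^T\!ds\,W(x_{st},t-s),\qquad \mu_{\lambda,T}(dx)=Z_{\lambda,T}^{-1}e^{-\lambda H_T(x)}\mu(dx).$$ The topology of local convergence on measures is the coarsest one for which $\nu\mapsto\int f\,d\nu$ is continuous for every bounded continuous $f:\mathcal X\to\mathbb R$ that is $\mathcal F_{[a,b]}$-measurable for some $a<b$. **Hypotheses.** For a continuous $W$ consider * (H1) There is $C$ with $\sup_{x\in\mathcal X}|U_{[a,b]}(x)|\le C(b-a)^2$ for all $a<b$, and $\sup_{x\in\mathcal X}\int_{\mathbb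 R}|W(x_{0t},|t|)|\,dt<\infty$. * (H2) There is $C$ such that for all $\xi\in\mathbb R^d$ $$\sup_{a\ge0}\sup_{x\in\mathcal X}\int_{-\infty}^0dt\int_0^\infty ds\,\big|W(\xi+x_{st},a+s-t)-W(x_{st},a+s-t)\big|\le C(1+|\xi|).$$ Assume that $W$ and its time reflection $(\xi,t)\mapsto W(\xi,-t)$ both satisfy (H1) and (H2). (If $W$ is even in $t$, this just says that $W$ satisfies (H1) and (H2).) **Conclusion.** The specification $\Pi$ is well defined: the integrals $V_I(x,y)$ converge absolutely and each $\pi_I(\cdot|y)$ is a probability measure. The $\mu_{\lambda,T}$, $T\ge1$, are probability measures and form a tight family on $\mathcal X$: for every $\varepsilon>0$ there is a compact $K\subset\mathcal X$ with $\mu_{\lambda,T}(K^c)\le\varepsilon$ for all $T\ge1$. Every probability measure on $\mathcal X$ that is a cluster point of $\mu_{\lambda,T}$ as $T\to\infty$ in the topology of local convergence is a Gibbs measure for $\Pi$. -/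

import Mathlib

open MeasureTheory ProbabilityTheory Set Filter
open scoped ENNReal NNReal BoundedContinuousFunction

noncomputable section

namespace BrownianIncrements

/-- The state space `ℝ^d` of the paths. -/
abbrev E (d : ℕ) : Type := EuclideanSpace ℝ (Fin d)

/-- The linear space of continuous increment fields `x : ℝ × ℝ → ℝ^d` with `x_{tt} = 0` and
`x_{su} + x_{ut} = x_{st}`. -/
def incrementSubmodule (d : ℕ) : Submodule ℝ C(ℝ × ℝ, E d) where
  carrier := {x | (∀ t, x (t, t) = 0) ∧ ∀ s t u, x (s, u) + x (u, t) = x (s, t)}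
  add_mem' := by
    rintro x y ⟨hx, hx'⟩ ⟨hy, hy'⟩
    refine ⟨fun t => by simp [hx, hy], fun s t u => ?_⟩
    simp only [ContinuousMap.add_apply, ← hx' s t u, ← hy' s t u]
    abel
  zero_mem' := by simp
  smul_mem' := by
    rintro c x ⟨hx, hx'⟩
    refine ⟨fun t => by simp [hx], fun s t u => ?_⟩
    simp only [ContinuousMap.smul_apply, ← hx' s t u, smul_add]

/-- The path space `𝒳`, with the topology of locally uniform convergence. -/
def IncrPath (d : ℕ) : Type := incrementSubmodule d

namespace IncrPath

variable {d : ℕ}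

/-- The compact-open topology of `C(ℝ × ℝ, ℝ^d)`, i.e. locally uniform convergence. -/
instance : TopologicalSpace (IncrPath d) := inferInstanceAs (TopologicalSpace (incrementSubmodule d))

instance : AddCommGroup (IncrPath d) := inferInstanceAs (AddCommGroup (incrementSubmodule d))

instance : MeasurableSpace (IncrPath d) := borel _

instance : BorelSpace (IncrPath d) := ⟨rfl⟩

/-- The increment `x_{st}`. -/
def inc (x : IncrPath d) (s t : ℝ) : E d := x.1 (s, t)

/-- The path `x ⊗_{[a,b]} y`: its increments inside `[a,b]` are those of `x`, its increments
inside `(-∞,a]` and inside `[b,∞)` are those of `y` (see `eq_splice_iff`). -/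
def splice (a b : ℝ) (x y : IncrPath d) : IncrPath d :=
  ⟨⟨fun p => x.1 (max a (min p.1 b), max a (min p.2 b))
      + y.1 (min p.1 a, min p.2 a) + y.1 (max p.1 b, max p.2 b), by fun_prop⟩, by
    refine ⟨fun t => ?_, fun s t u => ?_⟩
    · simp [x.2.1, y.2.1]
    · simp only [ContinuousMap.coe_mk]
      rw [← x.2.2 (max a (min s b)) (max a (min t b)) (max a (min u b)),
        ← y.2.2 (min s a) (min t a) (min u a), ← y.2.2 (max s b) (max t b) (max u b)]
      abel⟩

theorem eq_splice_iff {a b : ℝ} (hab : a ≤ b) (x y z : IncrPath d) :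
    z = splice a b x y ↔
      (∀ s ∈ Icc a b, ∀ t ∈ Icc a b, z.inc s t = x.inc s t) ∧
      (∀ s ∈ Iic a, ∀ t ∈ Iic a, z.inc s t = y.inc s t) ∧
      (∀ s ∈ Ici b, ∀ t ∈ Ici b, z.inc s t = y.inc s t) := by
  constructor
  · rintro rfl
    refine ⟨fun s hs t ht => ?_, fun s hs t ht => ?_, fun s hs t ht => ?_⟩
    · simp only [mem_Icc] at hs ht
      simp [inc, splice, hs.1, hs.2, ht.1, ht.2, y.2.1]
    · simp only [mem_Iic] at hs ht
      simp [inc, splice, hs, ht, hs.trans hab, ht.trans hab, x.2.1, y.2.1]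
    · simp only [mem_Ici] at hs ht
      simp [inc, splice, hs, ht, hab, hab.trans hs, hab.trans ht, x.2.1, y.2.1]
  · rintro ⟨h1, h2, h3⟩
    have key : ∀ u v : ℝ, z.1 (u, v) = z.1 (max a (min u b), max a (min v b))
        + z.1 (min u a, min v a) + z.1 (max u b, max v b) := by
      have base : ∀ u : ℝ, z.1 (a, u) = z.1 (a, max a (min u b))
          + z.1 (a, min u a) + z.1 (b, max u b) := by
        intro u
        rcases le_total u a with h | h
        · simp [h, h.trans hab, z.2.1]
        · rcases le_total u b with h' | h'
          · simp [h, h', z.2.1]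
          · simp [h, h', hab, z.2.1, z.2.2]
      intro u v
      have e : ∀ c p q : ℝ, z.1 (p, q) = z.1 (c, q) - z.1 (c, p) := fun c p q => by
        rw [← z.2.2 c q p]; abel
      rw [e a u v, e a (max a (min u b)), e a (min u a), e b (max u b), base u, base v]
      abel
    apply Subtype.ext
    ext1 p
    obtain ⟨u, v⟩ := p
    rw [key]
    have q1 := h1 (max a (min u b)) ⟨le_max_left _ _, max_le hab (min_le_right _ _)⟩
      (max a (min v b)) ⟨le_max_left _ _, max_le hab (min_le_right _ _)⟩
    have q2 := h2 (min u a) (mem_Iic.2 (min_le_right _ _)) (min v a)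
      (mem_Iic.2 (min_le_right _ _))
    have q3 := h3 (max u b) (mem_Ici.2 (le_max_right _ _)) (max v b)
      (mem_Ici.2 (le_max_right _ _))
    simp only [inc] at q1 q2 q3
    simp [splice, q1, q2, q3]

end IncrPath

/-- The `σ`-field `𝓕_I = σ(X_{st} : [s,t] ⊆ I)`. -/
abbrev incrementField (d : ℕ) (I : Set ℝ) : MeasurableSpace (IncrPath d) :=
  ⨆ (p : ℝ × ℝ) (_ : p.1 ≤ p.2 ∧ Icc p.1 p.2 ⊆ I),
    MeasurableSpace.comap (fun x : IncrPath d => x.inc p.1 p.2) inferInstance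

/-- `μ` is the law on `𝒳` of the increments `X_{st} = B_t - B_s` of a two-sided `d`-dimensional
Brownian motion `B`: `X_{st}` is a centred Gaussian vector with covariance `|s - t|` times the
identity, and increments over successive intervals are independent
(note that `X_{0t} - X_{0s} = X_{st}`). -/
structure IsBrownianIncrementLaw {d : ℕ} (μ : Measure (IncrPath d)) : Prop where
  isProbabilityMeasure : IsProbabilityMeasure μ
  law_inc : ∀ s t : ℝ,
    μ.map (fun x => x.inc s t) = (stdGaussian (E d)).map (fun z => √|s - t| • z)
  indep : HasIndepIncrements (fun (t : ℝ) (x : IncrPath d) => x.inc 0 t) μ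

section Potentials

variable {d : ℕ} (W : E d → ℝ → ℝ)

/-- The internal energy `U_I(x)`, `I = [a,b]`. -/
def U (a b : ℝ) (x : IncrPath d) : ℝ :=
  ∫ p in Icc a b ×ˢ Icc a b, W (x.inc p.1 p.2) (p.2 - p.1)

/-- The cone of influence `J(I)`, `I = [a,b]`. -/
def cone (a b : ℝ) : Set (ℝ × ℝ) :=
  Ioi b ×ˢ Iio a ∪ Iio a ×ˢ Ioi b ∪ Icc a b ×ˢ (Icc a b)ᶜ ∪ (Icc a b)ᶜ ×ˢ Icc a b

/-- The integrand of the relative interaction energy `V_I(x,y)` at `p = (s,t)`. -/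
def relW (a b : ℝ) (x y : IncrPath d) (p : ℝ × ℝ) : ℝ :=
  W ((IncrPath.splice a b x y).inc p.1 p.2) (p.2 - p.1)
    - W ((IncrPath.splice a b 0 y).inc p.1 p.2) (p.2 - p.1)

/-- The relative interaction energy `V_I(x,y)`, `I = [a,b]`. -/
def V (a b : ℝ) (x y : IncrPath d) : ℝ :=
  ∫ p in cone a b, relW W a b x y p

/-- The finite-volume energy `H_T(x) = ∫_{-T}^T dt ∫_{-T}^T ds W(x_{st}, t - s)`. -/
def H (T : ℝ) (x : IncrPath d) : ℝ :=
  ∫ t in (-T)..T, ∫ s in (-T)..T, W (x.inc s t) (t - s)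

/-- `Q(x,ξ,a) = ∫_{-∞}^0 dt ∫_0^∞ ds |W(ξ + x_{st}, a + s - t) - W(x_{st}, a + s - t)|`. -/
def Q (x : IncrPath d) (ξ : E d) (a : ℝ) : ℝ≥0∞ :=
  ∫⁻ t in Iic (0 : ℝ), ∫⁻ s in Ici (0 : ℝ),
    ‖W (ξ + x.inc s t) (a + s - t) - W (x.inc s t) (a + s - t)‖ₑ

/-- Hypothesis (H1). -/
def H1 : Prop :=
  (∃ C : ℝ, ∀ a b : ℝ, a < b → ∀ x : IncrPath d, |U W a b x| ≤ C * (b - a) ^ 2) ∧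
    (⨆ x : IncrPath d, ∫⁻ t : ℝ, ‖W (x.inc 0 t) |t|‖ₑ) < ∞

/-- Hypothesis (H2). -/
def H2 : Prop :=
  ∃ C : ℝ≥0, ∀ ξ : E d, (⨆ (a : ℝ) (_ : 0 ≤ a) (x : IncrPath d), Q W x ξ a) ≤ C * (1 + ‖ξ‖ₑ)

/-- The time reflection `(ξ,t) ↦ W(ξ,-t)` of a potential. -/
def reflect : E d → ℝ → ℝ := fun ξ t => W ξ (-t)

/-- The finite-volume measure `μ_{λ,T}(dx) = Z_{λ,T}⁻¹ exp(-λ H_T(x)) μ(dx)`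
(`lam` stands for `λ`). -/
def finiteVolume (μ : Measure (IncrPath d)) (lam T : ℝ) : Measure (IncrPath d) :=
  μ.tilted fun x => -lam * H W T x

/-- The kernel `π_I(·|y)`, `I = [a,b]`, of the specification `Π`: the law of `x ⊗_I y` when the
increments `x` in `I` are drawn from `Z_I(y)⁻¹ exp(-λ U_I(x) - λ V_I(x,y)) μ_I(dx)`. Both the
density and `x ⊗_I y` depend on `x` only through its restriction to `I`, so `x` may be drawn
under `μ` instead of its restriction `μ_I`. -/
def spec (μ : Measure (IncrPath d)) (lam a b : ℝ) (y : IncrPath d) : Measure (IncrPath d) :=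
  (μ.tilted fun x => -lam * U W a b x - lam * V W a b x y).map fun x => IncrPath.splice a b x y

/-- The specification `Π` is well defined: the integrals `V_I(x,y)` converge absolutely and every
`π_I(·|y)` is a probability measure. -/
def SpecWellDefined (μ : Measure (IncrPath d)) (lam : ℝ) : Prop :=
  ∀ a b : ℝ, a < b → ∀ y : IncrPath d,
    (∀ x : IncrPath d, IntegrableOn (relW W a b x y) (cone a b)) ∧
      IsProbabilityMeasure (spec W μ lam a b y)

/-- `ν` is a Gibbs measure for `Π`: `ν` is a probability measure and for every interval
`I = [a,b]`, `π_I(A|·)` is a version of the conditional probability `ν(A | 𝓕_{I^c})`. -/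
structure IsGibbs (μ : Measure (IncrPath d)) (lam : ℝ) (ν : Measure (IncrPath d)) : Prop where
  isProbabilityMeasure : IsProbabilityMeasure ν
  dlr : ∀ a b : ℝ, a < b → ∀ A : Set (IncrPath d), MeasurableSet A →
    (fun y => (spec W μ lam a b y).real A)
      =ᵐ[ν] ν[A.indicator (fun _ => (1 : ℝ)) | incrementField d (Icc a b)ᶜ]

end Potentials

/-- Bounded continuous local functions: those measurable with respect to `𝓕_{[a,b]}` for some
`a < b`. -/
def LocalFunction (d : ℕ) : Type :=
  {f : IncrPath d →ᵇ ℝ // ∃ a b : ℝ, a < b ∧ Measurable[incrementField d (Icc a b)] f}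

/-- The topology of local convergence: the coarsest topology for which `ν ↦ ∫ f dν` is continuous
for every bounded continuous local function `f`. -/
abbrev localTopology (d : ℕ) : TopologicalSpace (Measure (IncrPath d)) :=
  TopologicalSpace.induced (fun ν (f : LocalFunction d) => ∫ x, f.1 x ∂ν) inferInstance

end BrownianIncrements

end

open BrownianIncrements

/-!
Fix an interval `I = [a,b]`. Changing the increments of a path inside `I` changes its energy by the
integral over the time plane of `relW`, the difference of `W` along `x ⊗_I y` and along
`0 ⊗_I y`. The hypotheses bound the integral of `|relW|` by `K (1 + ‖x_{ab}‖)` with `K` independent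
of `x` and `y` (`exists_lintegral_relW_le`): (H1) controls the strips in which one of the two times
lies in `I`, and (H2) the interaction between past and future, in which the path feels only the
increment `x_{ab}`. Since `x_{ab}` is Gaussian, all Boltzmann weights are dominated by one
`μ`-integrable function, and normalizing constants are bounded away from zero. This makes the
specification well defined.

For every region `S` of the time plane there is a kernel `resample`, which redraws the increments
inside `I` with the Boltzmann weight of the energy of `S`. The specification is the case `S = univ`
(`spec_eq_resample`). Under the Brownian law the increments inside and outside `I` are independent
(`indepFun_inner_outer`), so `μ_{λ,T}` is invariant under the kernel with `S = [-T,T]²`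
(`bind_resample_finiteVolume`).

Tightness: by this invariance the law under `μ_{λ,T}` of the path in a window `[-N,N]` is dominated
by a finite measure which does not depend on `T`. Finite measures on a Polish space are tight, and
a set of paths all of whose windows are confined to compact sets is relatively compact.

Gibbs property: the kernels with `S = [-R,R]²` are local and continuous in the boundary condition
and they approximate the specification uniformly (`exists_abs_integral_resample_sub_le`), so the
invariance passes to every local cluster point. As the kernels do not change the path outside `I`,
invariance is the DLR equation. Uniformity of the approximation is the point at which (H1) and (H2),
which bound integrals uniformly in the path but say nothing on the uniformity of their convergence,
have to be sharpened. This is done in `exists_uniform_tail`: a path with a heavy tail could be glued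
to a path which nearly maximizes the integral within a bounded window, and the glued path would
exceed the maximum.
-/

namespace BrownianIncrements

/-! ### The path space -/

namespace IncrPath

variable {d : ℕ}

theorem isClosed_incrementSubmodule : IsClosed (incrementSubmodule d : Set C(ℝ × ℝ, E d)) := by
  have h : (incrementSubmodule d : Set C(ℝ × ℝ, E d)) =
      (⋂ t : ℝ, {x | x (t, t) = 0}) ∩
        ⋂ (s : ℝ) (t : ℝ) (u : ℝ), {x | x (s, u) + x (u, t) = x (s, t)} := by
    ext x
    simp [incrementSubmodule]
  rw [h]
  refine (isClosed_iInter fun t => ?_).inter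
    (isClosed_iInter fun s => isClosed_iInter fun t => isClosed_iInter fun u => ?_)
  · exact isClosed_eq (by fun_prop) (by fun_prop)
  · exact isClosed_eq (by fun_prop) (by fun_prop)

instance : PolishSpace (IncrPath d) := isClosed_incrementSubmodule.polishSpace

theorem inc_self (x : IncrPath d) (t : ℝ) : x.inc t t = 0 := x.2.1 t

theorem inc_add (x : IncrPath d) (s u t : ℝ) : x.inc s u + x.inc u t = x.inc s t := x.2.2 s t u

theorem inc_swap (x : IncrPath d) (s t : ℝ) : x.inc t s = -x.inc s t := by
  rw [eq_neg_iff_add_eq_zero, inc_add, inc_self]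

/-- Every increment is a difference of two increments from a common base point. -/
theorem inc_eq_sub (x : IncrPath d) (c s t : ℝ) : x.inc s t = x.inc c t - x.inc c s := by
  rw [← x.inc_add c s t]; abel

@[simp] theorem inc_zero (s t : ℝ) : (0 : IncrPath d).inc s t = 0 := rfl

@[ext] theorem ext {x y : IncrPath d} (h : ∀ s t, x.inc s t = y.inc s t) : x = y := by
  apply Subtype.ext
  ext1 ⟨s, t⟩
  exact h s t

theorem continuous_val : Continuous (fun x : IncrPath d => (x.1 : C(ℝ × ℝ, E d))) :=
  continuous_subtype_val

theorem continuous_inc_uncurry :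
    Continuous fun q : IncrPath d × (ℝ × ℝ) => q.1.inc q.2.1 q.2.2 := by
  have h : Continuous fun q : C(ℝ × ℝ, E d) × (ℝ × ℝ) => q.1 q.2 := continuous_eval
  exact h.comp ((continuous_val.comp continuous_fst).prodMk continuous_snd)

theorem continuous_inc {α : Type*} [TopologicalSpace α] {x : α → IncrPath d} {s t : α → ℝ}
    (hx : Continuous x) (hs : Continuous s) (ht : Continuous t) :
    Continuous fun a => (x a).inc (s a) (t a) :=
  continuous_inc_uncurry.comp (hx.prodMk (hs.prodMk ht))

theorem measurable_inc (s t : ℝ) : Measurable fun x : IncrPath d => x.inc s t :=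
  (continuous_inc continuous_id continuous_const continuous_const).measurable

/-- The path with increments `f t - f s`. -/
def ofFun (f : ℝ → E d) (hf : Continuous f) : IncrPath d :=
  ⟨⟨fun p => f p.2 - f p.1, by fun_prop⟩, by
    refine ⟨fun t => by simp, fun s t u => ?_⟩
    simp only [ContinuousMap.coe_mk]
    abel⟩

@[simp] theorem inc_ofFun (f : ℝ → E d) (hf : Continuous f) (s t : ℝ) :
    (ofFun f hf).inc s t = f t - f s := rfl

/-- The Borel `σ`-field of the path space is generated by the increments: the countably many
increments at rational times form an injective continuous map between Polish spaces, which is a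
measurable embedding by the Lusin-Souslin theorem. -/
theorem measurable_of_inc {α : Type*} {m : MeasurableSpace α} {f : α → IncrPath d}
    (h : ∀ t, Measurable fun a => (f a).inc 0 t) : Measurable f := by
  let e : IncrPath d → (ℚ → E d) := fun x q => x.inc 0 q
  have he : Continuous e :=
    continuous_pi fun q => continuous_inc continuous_id continuous_const continuous_const
  have hinj : Function.Injective e := by
    intro x y hxy
    have h0 : (fun t : ℝ => x.inc 0 t) = fun t => y.inc 0 t :=
      Rat.denseRange_cast.equalizer
        (continuous_inc continuous_const continuous_const continuous_id)
        (continuous_inc continuous_const continuous_const continuous_id)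
        (funext fun q => congrFun hxy q)
    ext1 s t
    rw [x.inc_eq_sub 0, y.inc_eq_sub 0]
    exact congrArg₂ _ (congrFun h0 t) (congrFun h0 s)
  have hemb := he.measurableEmbedding hinj
  refine hemb.measurable_comp_iff.1 ?_
  exact measurable_pi_lambda _ fun q => h q

theorem inc_splice (a b : ℝ) (x y : IncrPath d) (s t : ℝ) :
    (splice a b x y).inc s t = x.inc (max a (min s b)) (max a (min t b))
      + y.inc (min s a) (min t a) + y.inc (max s b) (max t b) := rfl

theorem continuous_splice (a b : ℝ) :
    Continuous fun q : IncrPath d × IncrPath d => splice a b q.1 q.2 := by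
  let φ : C(ℝ × ℝ, ℝ × ℝ) := ⟨fun p => (max a (min p.1 b), max a (min p.2 b)), by fun_prop⟩
  let ψ : C(ℝ × ℝ, ℝ × ℝ) := ⟨fun p => (min p.1 a, min p.2 a), by fun_prop⟩
  let χ : C(ℝ × ℝ, ℝ × ℝ) := ⟨fun p => (max p.1 b, max p.2 b), by fun_prop⟩
  have h : Continuous fun q : IncrPath d × IncrPath d =>
      ((q.1.1 : C(ℝ × ℝ, E d)).comp φ + (q.2.1 : C(ℝ × ℝ, E d)).comp ψ
        + (q.2.1 : C(ℝ × ℝ, E d)).comp χ : C(ℝ × ℝ, E d)) :=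
    (((ContinuousMap.continuous_precomp φ).comp (continuous_val.comp continuous_fst)).add
      ((ContinuousMap.continuous_precomp ψ).comp (continuous_val.comp continuous_snd))).add
      ((ContinuousMap.continuous_precomp χ).comp (continuous_val.comp continuous_snd))
  exact Continuous.subtype_mk h _

theorem continuous_splice_left (a b : ℝ) (y : IncrPath d) : Continuous fun x => splice a b x y :=
  (continuous_splice a b).comp (continuous_id.prodMk continuous_const)

theorem continuous_splice_right (a b : ℝ) (x : IncrPath d) : Continuous fun y => splice a b x y :=
  (continuous_splice a b).comp (continuous_const.prodMk continuous_id)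

theorem measurable_splice (a b : ℝ) :
    Measurable fun q : IncrPath d × IncrPath d => splice a b q.1 q.2 :=
  (continuous_splice a b).measurable

theorem splice_self {a b : ℝ} (hab : a ≤ b) (x : IncrPath d) : splice a b x x = x :=
  ((eq_splice_iff hab x x x).2 ⟨by simp, by simp, by simp⟩).symm

theorem inc_splice_inside {a b : ℝ} {x y : IncrPath d} {s t : ℝ} (hs : s ∈ Icc a b)
    (ht : t ∈ Icc a b) : (splice a b x y).inc s t = x.inc s t :=
  ((eq_splice_iff (hs.1.trans hs.2) x y _).1 rfl).1 s hs t ht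

theorem inc_splice_left {a b : ℝ} (hab : a ≤ b) {x y : IncrPath d} {s t : ℝ} (hs : s ≤ a)
    (ht : t ≤ a) : (splice a b x y).inc s t = y.inc s t :=
  ((eq_splice_iff hab x y _).1 rfl).2.1 s hs t ht

theorem inc_splice_right {a b : ℝ} (hab : a ≤ b) {x y : IncrPath d} {s t : ℝ} (hs : b ≤ s)
    (ht : b ≤ t) : (splice a b x y).inc s t = y.inc s t :=
  ((eq_splice_iff hab x y _).1 rfl).2.2 s hs t ht

/-- A spliced path depends only on the increments of `x` inside and of `y` outside `[a,b]`. -/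
theorem splice_congr {a b : ℝ} (hab : a ≤ b) {x x' y y' : IncrPath d}
    (h1 : ∀ s ∈ Icc a b, ∀ t ∈ Icc a b, x.inc s t = x'.inc s t)
    (h2 : ∀ s ∈ Iic a, ∀ t ∈ Iic a, y.inc s t = y'.inc s t)
    (h3 : ∀ s ∈ Ici b, ∀ t ∈ Ici b, y.inc s t = y'.inc s t) :
    splice a b x y = splice a b x' y' := by
  rw [eq_splice_iff hab]
  refine ⟨fun s hs t ht => ?_, fun s hs t ht => ?_, fun s hs t ht => ?_⟩
  · rw [inc_splice_inside hs ht, h1 s hs t ht]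
  · rw [inc_splice_left hab hs ht, h2 s hs t ht]
  · rw [inc_splice_right hab hs ht, h3 s hs t ht]

theorem splice_splice_right {a b : ℝ} (hab : a ≤ b) (x y z : IncrPath d) :
    splice a b x (splice a b y z) = splice a b x z :=
  splice_congr hab (fun _ _ _ _ => rfl) (fun _ hs _ ht => inc_splice_left hab hs ht)
    (fun _ hs _ ht => inc_splice_right hab hs ht)

theorem splice_splice_left {a b : ℝ} (hab : a ≤ b) (x y z : IncrPath d) :
    splice a b (splice a b x y) z = splice a b x z :=
  splice_congr hab (fun _ hs _ ht => inc_splice_inside hs ht) (fun _ _ _ _ => rfl)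
    (fun _ _ _ _ => rfl)

/-- Paths whose increments agree inside a window agree there after splicing as well. -/
theorem splice_inner_congr {a b M : ℝ} (ha : -M ≤ a) (hb : b ≤ M)
    (x y : IncrPath d) :
    ∀ s ∈ Icc (-M) M, ∀ t ∈ Icc (-M) M,
      (splice a b x (splice (-M) M y 0)).inc s t = (splice a b x y).inc s t := by
  intro s hs t ht
  simp only [mem_Icc] at hs ht
  rw [inc_splice, inc_splice a b x y]
  rw [inc_splice_inside (x := y) ⟨le_min hs.1 ha, (min_le_left _ _).trans hs.2⟩
      ⟨le_min ht.1 ha, (min_le_left _ _).trans ht.2⟩,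
    inc_splice_inside (x := y) ⟨hs.1.trans (le_max_left _ _), max_le hs.2 hb⟩
      ⟨ht.1.trans (le_max_left _ _), max_le ht.2 hb⟩]

end IncrPath

open IncrPath

variable {d : ℕ}

/-! ### The `σ`-fields of increments -/

theorem incrementField_le (I : Set ℝ) :
    incrementField d I ≤ (inferInstance : MeasurableSpace (IncrPath d)) :=
  iSup₂_le fun p _ => (measurable_inc p.1 p.2).comap_le

theorem measurable_inc_incrementField_of_le {I : Set ℝ} {s t : ℝ} (hst : s ≤ t)
    (h : Icc s t ⊆ I) : Measurable[incrementField d I] fun x : IncrPath d => x.inc s t :=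
  Measurable.of_comap_le (le_iSup₂_of_le (s, t) ⟨hst, h⟩ le_rfl)

theorem measurable_inc_incrementField {I : Set ℝ} (hI : I.OrdConnected) {s t : ℝ} (hs : s ∈ I)
    (ht : t ∈ I) : Measurable[incrementField d I] fun x : IncrPath d => x.inc s t := by
  rcases le_total s t with h | h
  · exact measurable_inc_incrementField_of_le h (hI.out hs ht)
  · have := (measurable_inc_incrementField_of_le (d := d) h (hI.out ht hs)).neg
    have e : (fun x : IncrPath d => x.inc s t) = fun x => -x.inc t s :=
      funext fun x => x.inc_swap t s
    rw [e]
    exact this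

theorem incrementField_mono {I J : Set ℝ} (h : I ⊆ J) : incrementField d I ≤ incrementField d J :=
  iSup₂_le fun p hp => le_iSup₂_of_le p ⟨hp.1, hp.2.trans h⟩ le_rfl

/-- The part of the path inside `[a,b]` is `𝓕_{[a,b]}`-measurable. -/
theorem measurable_inner {a b : ℝ} (hab : a ≤ b) :
    @Measurable _ _ (incrementField d (Icc a b)) _ fun x : IncrPath d => splice a b x 0 := by
  refine measurable_of_inc (m := incrementField d (Icc a b)) fun t => ?_
  simp only [inc_splice, inc_zero, add_zero]
  exact measurable_inc_incrementField ordConnected_Icc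
    ⟨le_max_left _ _, max_le hab (min_le_right _ _)⟩
    ⟨le_max_left _ _, max_le hab (min_le_right _ _)⟩

/-- The part of the path outside `[a,b]` is `𝓕_{[a,b]ᶜ}`-measurable. The increments between
points `≤ a` are limits of increments between points `< a`, and similarly on the other side. -/
theorem measurable_outer (a b : ℝ) :
    @Measurable _ _ (incrementField d (Icc a b)ᶜ) _ fun y : IncrPath d => splice a b 0 y := by
  have hlim : Tendsto (fun n : ℕ => 1 / ((n : ℝ) + 1)) atTop (nhds 0) :=
    tendsto_one_div_add_atTop_nhds_zero_nat
  have hpos : ∀ n : ℕ, 0 < 1 / ((n : ℝ) + 1) := fun n => Nat.one_div_pos_of_nat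
  have hL : ∀ u v : ℝ, u ≤ a → v ≤ a →
      Measurable[incrementField d (Icc a b)ᶜ] fun y : IncrPath d => y.inc u v := by
    intro u v hu hv
    refine @measurable_of_tendsto_metrizable _ _ (incrementField d (Icc a b)ᶜ) _ _ _ _
      (fun (n : ℕ) y => y.inc (u - 1 / ((n : ℝ) + 1)) (v - 1 / ((n : ℝ) + 1))) _ (fun n => ?_) ?_
    · refine (measurable_inc_incrementField (I := Iio a) ordConnected_Iio ?_ ?_).mono
        (incrementField_mono fun r hr => ?_) le_rfl
      · simp only [mem_Iio]; linarith [hpos n]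
      · simp only [mem_Iio]; linarith [hpos n]
      · simp only [mem_Iio] at hr; simp [hr]
    · rw [tendsto_pi_nhds]
      intro y
      have hc : Continuous fun ε : ℝ => y.inc (u - ε) (v - ε) :=
        continuous_inc continuous_const (by fun_prop) (by fun_prop)
      have := (hc.tendsto 0).comp hlim
      simpa [Function.comp_def] using this
  have hR : ∀ u v : ℝ, b ≤ u → b ≤ v →
      Measurable[incrementField d (Icc a b)ᶜ] fun y : IncrPath d => y.inc u v := by
    intro u v hu hv
    refine @measurable_of_tendsto_metrizable _ _ (incrementField d (Icc a b)ᶜ) _ _ _ _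
      (fun (n : ℕ) y => y.inc (u + 1 / ((n : ℝ) + 1)) (v + 1 / ((n : ℝ) + 1))) _ (fun n => ?_) ?_
    · refine (measurable_inc_incrementField (I := Ioi b) ordConnected_Ioi ?_ ?_).mono
        (incrementField_mono fun r hr => ?_) le_rfl
      · simp only [mem_Ioi]; linarith [hpos n]
      · simp only [mem_Ioi]; linarith [hpos n]
      · simp only [mem_Ioi] at hr; simp [hr]
    · rw [tendsto_pi_nhds]
      intro y
      have hc : Continuous fun ε : ℝ => y.inc (u + ε) (v + ε) :=
        continuous_inc continuous_const (by fun_prop) (by fun_prop)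
      have := (hc.tendsto 0).comp hlim
      simpa [Function.comp_def] using this
  refine measurable_of_inc (m := incrementField d (Icc a b)ᶜ) fun t => ?_
  simp only [inc_splice, inc_zero, zero_add]
  exact (hL _ _ (min_le_right _ _) (min_le_right _ _)).add
    (hR _ _ (le_max_right _ _) (le_max_right _ _))

/-- An `𝓕_{[a,b]ᶜ}`-measurable event is not affected by a change of the path inside `[a,b]`. -/
theorem splice_mem_iff {a b : ℝ} (hab : a ≤ b) {B : Set (IncrPath d)}
    (hB : MeasurableSet[incrementField d (Icc a b)ᶜ] B) (x y : IncrPath d) :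
    splice a b x y ∈ B ↔ y ∈ B := by
  have hle : incrementField d (Icc a b)ᶜ ≤
      MeasurableSpace.comap (fun y : IncrPath d => splice a b 0 y) inferInstance := by
    refine iSup₂_le fun p hp => ?_
    have hcase : (p.1 ≤ a ∧ p.2 ≤ a) ∨ (b ≤ p.1 ∧ b ≤ p.2) := by
      have h1 := hp.2 (left_mem_Icc.2 hp.1)
      have h2 := hp.2 (right_mem_Icc.2 hp.1)
      simp only [mem_compl_iff, mem_Icc, not_and_or, not_le] at h1 h2
      rcases h1 with h1 | h1
      · rcases h2 with h2 | h2
        · exact .inl ⟨h1.le, h2.le⟩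
        · exact absurd ⟨le_rfl, hab⟩ (hp.2 ⟨h1.le, hab.trans h2.le⟩)
      · exact .inr ⟨h1.le, h1.le.trans hp.1⟩
    have heq : (fun y : IncrPath d => y.inc p.1 p.2) =
        (fun z : IncrPath d => z.inc p.1 p.2) ∘ fun y => splice a b 0 y := by
      funext y
      rcases hcase with h | h
      · exact (inc_splice_left hab h.1 h.2).symm
      · exact (inc_splice_right hab h.1 h.2).symm
    rw [heq, ← MeasurableSpace.comap_comp]
    exact MeasurableSpace.comap_mono (measurable_inc _ _).comap_le
  obtain ⟨B', -, rfl⟩ := hle B hB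
  simp only [mem_preimage, splice_splice_right hab]

/-! ### Independence of the increments inside and outside an interval -/

/-- A nonempty finite set of times is the range of a monotone sequence. -/
theorem exists_monotone_enumeration (F : Finset ℝ) (hF : F.Nonempty) :
    ∃ t : ℕ → ℝ, Monotone t ∧ ∀ u ∈ F, ∃ i, t i = u := by
  have hc : 0 < F.card := hF.card_pos
  refine ⟨fun i => F.orderEmbOfFin rfl ⟨min i (F.card - 1), by omega⟩, fun i j hij => ?_,
    fun u hu => ?_⟩
  · refine (F.orderEmbOfFin rfl).monotone ?_
    simp only [Fin.mk_le_mk]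
    omega
  · have : u ∈ Set.range (F.orderEmbOfFin rfl) := by rw [F.range_orderEmbOfFin]; exact hu
    obtain ⟨i, rfl⟩ := this
    refine ⟨i, congrArg _ (Fin.ext ?_)⟩
    have := i.2
    simp only
    omega

/-- The `σ`-field generated by the successive increments of `t` with index in `P`. -/
abbrev stepField (d : ℕ) (t : ℕ → ℝ) (P : Set ℕ) : MeasurableSpace (IncrPath d) :=
  ⨆ k ∈ P, MeasurableSpace.comap (fun x : IncrPath d => x.inc 0 (t (k + 1)) - x.inc 0 (t k))
    inferInstance

theorem measurable_inc_stepField {t : ℕ → ℝ} (ht : Monotone t) {P : Set ℕ} {i j : ℕ} (hij : i ≤ j)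
    (hP : ∀ k, i ≤ k → k < j → t k < t (k + 1) → k ∈ P) :
    Measurable[stepField d t P] fun x : IncrPath d => x.inc (t i) (t j) := by
  induction j, hij using Nat.le_induction with
  | base => simp only [inc_self]; exact measurable_const
  | succ j hij ih =>
    have h1 := ih fun k hk hkj => hP k hk (hkj.trans (Nat.lt_succ_self j))
    have h2 : Measurable[stepField d t P] fun x : IncrPath d => x.inc (t j) (t (j + 1)) := by
      rcases (ht (Nat.le_succ j)).eq_or_lt with h | h
      · simp only [← Nat.succ_eq_add_one, ← h, inc_self]; exact measurable_const
      · have hj := hP j hij (Nat.lt_succ_self j) h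
        simp only [fun x : IncrPath d => x.inc_eq_sub 0 (t j) (t (j + 1))]
        exact Measurable.of_comap_le (le_iSup₂_of_le j hj le_rfl)
    simp only [fun x : IncrPath d => (x.inc_add (t i) (t j) (t (j + 1))).symm]
    exact h1.add h2

theorem indepFun_inner_outer {μ : Measure (IncrPath d)} (hμ : IsBrownianIncrementLaw μ) {a b : ℝ}
    (hab : a ≤ b) :
    IndepFun (fun x => splice a b x 0) (fun x => splice a b 0 x) μ := by
  have := hμ.isProbabilityMeasure
  have hmi : Measurable fun x : IncrPath d => splice a b x 0 :=
    (continuous_splice_left a b 0).measurable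
  have hmo : Measurable fun x : IncrPath d => splice a b 0 x :=
    (continuous_splice_right a b 0).measurable
  -- The two paths are measurable functions of the families of their increments from `0`.
  suffices h : IndepFun (fun x (t : ℝ) => (splice a b x 0).inc 0 t)
      (fun x (t : ℝ) => (splice a b 0 x).inc 0 t) μ by
    have hle : ∀ f : IncrPath d → IncrPath d,
        MeasurableSpace.comap f inferInstance ≤
          MeasurableSpace.comap (fun x (t : ℝ) => (f x).inc 0 t) MeasurableSpace.pi := by
      intro f
      refine Measurable.comap_le ?_
      refine measurable_of_inc (m := MeasurableSpace.comap _ _) fun t => ?_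
      exact (measurable_pi_apply t).comp
        (comap_measurable fun x (t : ℝ) => (f x).inc 0 t)
    exact indep_of_indep_of_le_left (indep_of_indep_of_le_right h (hle _)) (hle _)
  refine IndepFun.process_indepFun_process (fun t => (measurable_inc 0 t).comp hmi)
    (fun t => (measurable_inc 0 t).comp hmo) fun I J => ?_
  -- All increments involved are sums of successive increments along a finite set of times.
  let F : Finset ℝ := I ∪ J ∪ {a, b, 0}
  obtain ⟨t, ht, htF⟩ := exists_monotone_enumeration F ⟨a, by simp [F]⟩
  let P : Set ℕ := {k | a ≤ t k ∧ t (k + 1) ≤ b ∧ t k < t (k + 1)}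
  let R : Set ℕ := {k | (t (k + 1) ≤ a ∨ b ≤ t k) ∧ t k < t (k + 1)}
  have hPR : Disjoint P R := by
    refine Set.disjoint_left.2 fun k hk hk' => ?_
    obtain ⟨h1, h2, h3⟩ := hk
    rcases hk'.1 with h | h <;> linarith
  have hindep : Indep (stepField d t P) (stepField d t R) μ :=
    indep_iSup_of_disjoint (fun k => ((measurable_inc _ _).sub (measurable_inc _ _)).comap_le)
      (hμ.indep.nat ht) hPR
  have hmeas : ∀ (Q : Set ℕ) (u v : ℝ), u ∈ F → v ∈ F →
      (∀ k, min u v ≤ t k → t (k + 1) ≤ max u v → t k < t (k + 1) → k ∈ Q) →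
      Measurable[stepField d t Q] fun x : IncrPath d => x.inc u v := by
    intro Q u v hu hv hQ
    obtain ⟨i, rfl⟩ := htF u hu
    obtain ⟨j, rfl⟩ := htF v hv
    rcases le_total i j with hij | hij
    · refine measurable_inc_stepField ht hij fun k hk hkj hlt => hQ k ?_ ?_ hlt
      · exact (min_le_left _ _).trans (ht hk)
      · exact (ht hkj).trans (le_max_right _ _)
    · simp only [fun x : IncrPath d => x.inc_swap (t j) (t i)]
      refine (measurable_inc_stepField ht hij fun k hk hkj hlt => hQ k ?_ ?_ hlt).neg
      · exact (min_le_right _ _).trans (ht hk)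
      · exact (ht hkj).trans (le_max_left _ _)
  have hF : ∀ u ∈ F, max a (min u b) ∈ F ∧ min u a ∈ F ∧ max u b ∈ F := by
    intro u hu
    have ha : a ∈ F := by simp [F]
    have hb : b ∈ F := by simp [F]
    refine ⟨?_, ?_, ?_⟩
    · rcases max_choice a (min u b) with h | h <;> rw [h]
      · exact ha
      · rcases min_choice u b with h | h <;> rw [h] <;> assumption
    · rcases min_choice u a with h | h <;> rw [h] <;> assumption
    · rcases max_choice u b with h | h <;> rw [h] <;> assumption
  have h0 : (0 : ℝ) ∈ F := by simp [F]
  refine indep_of_indep_of_le_left (indep_of_indep_of_le_right hindep ?_) ?_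
  · refine Measurable.comap_le
      (@measurable_pi_lambda _ _ _ (stepField d t R) _ _ fun j => ?_)
    have hj := hF j (by simp [F])
    simp only [inc_splice, inc_zero, zero_add]
    refine (hmeas R _ _ (hF 0 h0).2.1 hj.2.1 fun k _ hk hlt => ⟨.inl (hk.trans ?_), hlt⟩).add
      (hmeas R _ _ (hF 0 h0).2.2 hj.2.2 fun k hk _ hlt => ⟨.inr (le_trans ?_ hk), hlt⟩)
    · exact max_le (min_le_right _ _) (min_le_right _ _)
    · exact le_min (le_max_right _ _) (le_max_right _ _)
  · refine Measurable.comap_le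
      (@measurable_pi_lambda _ _ _ (stepField d t P) _ _ fun i => ?_)
    have hi := hF i (by simp [F])
    simp only [inc_splice, inc_zero, add_zero]
    refine hmeas P _ _ (hF 0 h0).1 hi.1 fun k hk hk' hlt => ⟨le_trans ?_ hk, hk'.trans ?_, hlt⟩
    · exact le_min (le_max_left _ _) (le_max_left _ _)
    · exact max_le (max_le hab (min_le_right _ _)) (max_le hab (min_le_right _ _))

/-- Resampling the increments inside `[a,b]` independently preserves the Brownian law. -/
theorem map_splice_prod {μ : Measure (IncrPath d)} (hμ : IsBrownianIncrementLaw μ) {a b : ℝ}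
    (hab : a ≤ b) :
    (μ.prod μ).map (fun q => splice a b q.1 q.2) = μ := by
  have := hμ.isProbabilityMeasure
  have hmi : Measurable fun x : IncrPath d => splice a b x 0 :=
    (continuous_splice_left a b 0).measurable
  have hmo : Measurable fun x : IncrPath d => splice a b 0 x :=
    (continuous_splice_right a b 0).measurable
  have h := (indepFun_iff_map_prod_eq_prod_map_map hmi.aemeasurable hmo.aemeasurable).1
    (indepFun_inner_outer hμ hab)
  rw [Measure.map_prod_map _ _ hmi hmo] at h
  have h2 := congrArg (Measure.map fun q : IncrPath d × IncrPath d => splice a b q.1 q.2) h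
  rw [Measure.map_map (measurable_splice a b) (hmi.prodMk hmo),
    Measure.map_map (measurable_splice a b) (by fun_prop)] at h2
  have e1 : ((fun q : IncrPath d × IncrPath d => splice a b q.1 q.2) ∘
      fun x => (splice a b x 0, splice a b 0 x)) = id := by
    funext x
    simp only [Function.comp_apply, splice_splice_left hab, splice_splice_right hab,
      splice_self hab, id]
  have e2 : ((fun q : IncrPath d × IncrPath d => splice a b q.1 q.2) ∘
      Prod.map (fun x => splice a b x 0) fun x => splice a b 0 x) =
      fun q => splice a b q.1 q.2 := by
    funext q
    simp only [Function.comp_apply, Prod.map_fst, Prod.map_snd, splice_splice_left hab,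
      splice_splice_right hab]
  rw [e1, e2, Measure.map_id] at h2
  exact h2.symm

/-- Brownian increments have finite exponential moments of all orders. -/
theorem integrable_exp_norm_inc {μ : Measure (IncrPath d)} (hμ : IsBrownianIncrementLaw μ)
    (a b c : ℝ) : Integrable (fun x : IncrPath d => Real.exp (c * ‖x.inc a b‖)) μ := by
  have := hμ.isProbabilityMeasure
  obtain ⟨γ, hγ, hint⟩ := IsGaussian.exists_integrable_exp_sq (stdGaussian (E d))
  set r : ℝ := √|a - b| with hr
  have h1 : Integrable (fun z : E d => Real.exp (c * ‖r • z‖)) (stdGaussian (E d)) := by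
    refine (hint.const_mul (Real.exp ((c * r) ^ 2 / (4 * γ)))).mono'
      (Continuous.aestronglyMeasurable (by fun_prop)) (ae_of_all _ fun z => ?_)
    rw [Real.norm_of_nonneg (Real.exp_pos _).le, ← Real.exp_add, norm_smul,
      Real.norm_of_nonneg (Real.sqrt_nonneg _)]
    refine Real.exp_le_exp.2 ?_
    -- `c r ‖z‖ ≤ (c r)² / (4 γ) + γ ‖z‖²`
    have : (c * r) ^ 2 / (4 * γ) + γ * ‖z‖ ^ 2 - c * (r * ‖z‖)
        = (c * r - 2 * γ * ‖z‖) ^ 2 / (4 * γ) := by field_simp; ring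
    have h2 : 0 ≤ (c * r - 2 * γ * ‖z‖) ^ 2 / (4 * γ) := by positivity
    linarith
  have hm : Measurable fun z : E d => r • z := by fun_prop
  have h2 : Integrable (fun z : E d => Real.exp (c * ‖z‖)) (μ.map fun x => x.inc a b) := by
    rw [hμ.law_inc, integrable_map_measure (Continuous.aestronglyMeasurable (by fun_prop))
      hm.aemeasurable]
    exact h1
  exact h2.comp_measurable (measurable_inc a b)

/-! ### Uniform tails from uniform bounds -/

/-- Let `h f`, `f ∈ ι`, be nonnegative functions with uniformly bounded integrals. If for each `n`
any two members of the family can be glued into a third one which agrees with the first on `B n`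
and with the second on `C n`, where `B n` exhausts the space, then the integrals of the `h f` over
`C n` become small uniformly in `f`: glue an arbitrary `f` to a near-maximizer `f₀` whose mass is
concentrated on `B n`. -/
theorem exists_uniform_tail {α ι : Type*} [MeasurableSpace α] (m : Measure α) (h : ι → α → ℝ≥0∞)
    (B C : ℕ → Set α) (hBm : ∀ n, MeasurableSet (B n))
    (hCm : ∀ n, MeasurableSet (C n)) (hB : Monotone B) (hBU : ⋃ n, B n = univ)
    (hBC : ∀ n, Disjoint (B n) (C n))
    (hglue : ∀ n f₀ f, ∃ g, (∀ p ∈ B n, h g p = h f₀ p) ∧ ∀ p ∈ C n, h g p = h f p)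
    {M : ℝ≥0∞} (hM : M ≠ ∞) (hbound : ∀ f, ∫⁻ p, h f p ∂m ≤ M) {ε : ℝ≥0∞} (hε : 0 < ε) :
    ∃ n, ∀ f, ∫⁻ p in C n, h f p ∂m ≤ ε := by
  rcases isEmpty_or_nonempty ι with hι | hι
  · exact ⟨0, fun f => isEmptyElim f⟩
  set S : ℝ≥0∞ := ⨆ f, ∫⁻ p, h f p ∂m with hS
  have hSM : S ≠ ∞ := ne_top_of_le_ne_top hM (iSup_le hbound)
  have hexh : ∀ f, ∫⁻ p, h f p ∂m = ⨆ n, ∫⁻ p in B n, h f p ∂m := fun f => by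
    rw [← setLIntegral_univ, ← hBU, setLIntegral_iUnion_of_directed _ hB.directed_le]
  obtain ⟨f₀, n, hn⟩ : ∃ f₀ n, S < ∫⁻ p in B n, h f₀ p ∂m + ε := by
    by_contra! hcon
    have : S + ε ≤ S := by
      conv_lhs => rw [hS]
      simp only [hexh, ENNReal.iSup_add]
      exact iSup_le fun f => iSup_le fun n => hcon f n
    exact absurd this (not_le.2 (ENNReal.lt_add_right hSM hε.ne'))
  refine ⟨n, fun f => ?_⟩
  obtain ⟨g, hg₁, hg₂⟩ := hglue n f₀ f
  have hle : ∫⁻ p in B n, h f₀ p ∂m + ∫⁻ p in C n, h f p ∂m ≤ S := by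
    rw [← setLIntegral_congr_fun (hBm n) hg₁, ← setLIntegral_congr_fun (hCm n) hg₂,
      ← lintegral_union (hCm n) (hBC n)]
    exact (setLIntegral_le_lintegral _ _).trans (le_iSup (fun f => ∫⁻ p, h f p ∂m) g)
  have hfin : ∫⁻ p in B n, h f₀ p ∂m ≠ ∞ := ne_top_of_le_ne_top hSM (le_self_add.trans hle)
  exact (ENNReal.add_le_add_iff_left hfin).1 (hle.trans hn.le)

/-- Two continuous functions can be interpolated between `[-n,n]` and the complement of
`(-n-1,n+1)`. -/
theorem exists_glue (n : ℕ) (f₀ f : C(ℝ, E d)) :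
    ∃ g : C(ℝ, E d), (∀ t : ℝ, |t| ≤ n → g t = f₀ t) ∧ ∀ t : ℝ, (n : ℝ) + 1 ≤ |t| → g t = f t := by
  let χ : ℝ → ℝ := fun t => max 0 (min 1 (|t| - n))
  have hχ : Continuous χ := by fun_prop
  refine ⟨⟨fun t => f₀ t + χ t • (f t - f₀ t), by fun_prop⟩, fun t ht => ?_, fun t ht => ?_⟩
  · have : χ t = 0 := max_eq_left ((min_le_right _ _).trans (by linarith))
    simp [this]
  · have : χ t = 1 := by
      simp only [χ]
      rw [min_eq_left (by linarith)]
      norm_num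
    simp [this]

/-! ### Self-interaction along strips -/

section Strips

variable {W : E d → ℝ → ℝ}

/-- The bounds of (H1) for `W` and for its time reflection combine into one over all times, positive
and negative. -/
theorem exists_lintegral_le (hH1 : H1 W) (hH1' : H1 (reflect W)) :
    ∃ M : ℝ≥0, ∀ f : C(ℝ, E d), ∫⁻ t, ‖W (f t - f 0) t‖ₑ ≤ M := by
  set M₁ := ⨆ x : IncrPath d, ∫⁻ t : ℝ, ‖W (x.inc 0 t) |t|‖ₑ with hM₁
  set M₂ := ⨆ x : IncrPath d, ∫⁻ t : ℝ, ‖reflect W (x.inc 0 t) |t|‖ₑ with hM₂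
  have h₁ : M₁ ≠ ∞ := hH1.2.ne
  have h₂ : M₂ ≠ ∞ := hH1'.2.ne
  refine ⟨(M₁ + M₂).toNNReal, fun f => ?_⟩
  rw [ENNReal.coe_toNNReal (ENNReal.add_ne_top.2 ⟨h₁, h₂⟩)]
  let x : IncrPath d := ofFun f f.continuous
  rw [← setLIntegral_univ, ← Iic_union_Ici (a := (0 : ℝ)), add_comm M₁]
  refine (lintegral_union_le _ _ _).trans ?_
  refine add_le_add ?_ ?_
  · refine le_trans ?_ (le_iSup (fun x : IncrPath d => ∫⁻ t : ℝ, ‖reflect W (x.inc 0 t) |t|‖ₑ) x)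
    refine le_trans (le_of_eq ?_) (setLIntegral_le_lintegral (Iic 0) _)
    refine setLIntegral_congr_fun measurableSet_Iic fun t ht => ?_
    simp only [x, inc_ofFun, reflect, abs_of_nonpos (mem_Iic.1 ht), neg_neg]
  · refine le_trans ?_ (le_iSup (fun x : IncrPath d => ∫⁻ t : ℝ, ‖W (x.inc 0 t) |t|‖ₑ) x)
    refine le_trans (le_of_eq ?_) (setLIntegral_le_lintegral (Ici 0) _)
    refine setLIntegral_congr_fun measurableSet_Ici fun t ht => ?_
    simp only [x, inc_ofFun, abs_of_nonneg (mem_Ici.1 ht)]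

theorem exists_lintegral_tail_le (hH1 : H1 W) (hH1' : H1 (reflect W)) {ε : ℝ≥0∞} (hε : 0 < ε) :
    ∃ n : ℕ, ∀ f : C(ℝ, E d), ∫⁻ t in {t | (n : ℝ) + 1 ≤ |t|}, ‖W (f t - f 0) t‖ₑ ≤ ε := by
  obtain ⟨M, hM⟩ := exists_lintegral_le hH1 hH1'
  refine exists_uniform_tail volume (fun (f : C(ℝ, E d)) t => ‖W (f t - f 0) t‖ₑ)
    (fun n => {t | |t| ≤ n}) (fun n => {t | (n : ℝ) + 1 ≤ |t|})
    (fun n => measurableSet_le (by fun_prop) (by fun_prop))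
    (fun n => measurableSet_le (by fun_prop) (by fun_prop)) ?_ ?_ ?_ ?_ ENNReal.coe_ne_top hM hε
  · intro n m hnm t ht
    exact le_trans (show |t| ≤ n from ht) (Nat.cast_le.2 hnm)
  · refine eq_univ_of_forall fun t => ?_
    obtain ⟨n, hn⟩ := exists_nat_ge |t|
    exact mem_iUnion.2 ⟨n, hn⟩
  · refine fun n => Set.disjoint_left.2 fun t ht ht' => ?_
    simp only [mem_ofPred_eq] at ht ht'
    linarith
  · intro n f₀ f
    obtain ⟨g, hg₁, hg₂⟩ := exists_glue n (f₀ - ContinuousMap.const ℝ (f₀ 0))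
      (f - ContinuousMap.const ℝ (f 0))
    have hg0 : g 0 = 0 := by rw [hg₁ 0 (by simp)]; simp
    refine ⟨g, fun t ht => ?_, fun t ht => ?_⟩
    · simp [hg0, hg₁ t ht]
    · simp [hg0, hg₂ t ht]

theorem continuous_W_inc (hW : Continuous (Function.uncurry W)) (x : IncrPath d) :
    Continuous fun p : ℝ × ℝ => W (x.inc p.1 p.2) (p.2 - p.1) :=
  hW.comp ((continuous_inc continuous_const continuous_fst continuous_snd).prodMk (by fun_prop))

/-- Integrals over a strip `{s ∈ A}` in the time plane are controlled by one-dimensional ones. -/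
theorem lintegral_strip_fst_le (hW : Continuous (Function.uncurry W)) {D : Set ℝ}
    (hD : MeasurableSet D) {η : ℝ≥0∞}
    (hη : ∀ f : C(ℝ, E d), ∫⁻ t in D, ‖W (f t - f 0) t‖ₑ ≤ η) {A : Set ℝ} (hA : MeasurableSet A)
    (x : IncrPath d) :
    ∫⁻ p in {p : ℝ × ℝ | p.1 ∈ A ∧ p.2 - p.1 ∈ D}, ‖W (x.inc p.1 p.2) (p.2 - p.1)‖ₑ
      ≤ η * volume A := by
  have hS : MeasurableSet {p : ℝ × ℝ | p.1 ∈ A ∧ p.2 - p.1 ∈ D} :=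
    (measurable_fst hA).inter ((measurable_snd.sub measurable_fst) hD)
  rw [← lintegral_indicator hS, Measure.volume_eq_prod,
    lintegral_prod _ ((continuous_W_inc hW x).enorm.measurable.indicator hS).aemeasurable,
    ← setLIntegral_const, ← lintegral_indicator hA]
  refine lintegral_mono fun s => ?_
  by_cases hs : s ∈ A
  · rw [indicator_of_mem hs, ← lintegral_add_left_eq_self _ s]
    let f : C(ℝ, E d) := ⟨fun r => x.inc 0 (s + r),
      continuous_inc continuous_const continuous_const (by fun_prop)⟩
    refine le_trans (le_of_eq ?_) (hη f)
    rw [← lintegral_indicator hD]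
    refine lintegral_congr fun r => ?_
    have : f r - f 0 = x.inc s (s + r) := by
      simp only [f, ContinuousMap.coe_mk, add_zero]
      exact (x.inc_eq_sub 0 _ _).symm
    have hr : (s, s + r) ∈ {p : ℝ × ℝ | p.1 ∈ A ∧ p.2 - p.1 ∈ D} ↔ r ∈ D := by simp [hs]
    by_cases h : r ∈ D
    · rw [indicator_of_mem h, indicator_of_mem (hr.2 h), this, add_sub_cancel_left]
    · rw [indicator_of_notMem h, indicator_of_notMem (mt hr.1 h)]
  · rw [indicator_of_notMem hs]
    simp [indicator, hs]

/-- Integrals over a strip `{t ∈ A}` in the time plane are controlled by one-dimensional ones. -/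
theorem lintegral_strip_snd_le (hW : Continuous (Function.uncurry W)) {D : Set ℝ}
    (hD : MeasurableSet D) {η : ℝ≥0∞}
    (hη : ∀ f : C(ℝ, E d), ∫⁻ t in D, ‖W (f t - f 0) t‖ₑ ≤ η) {A : Set ℝ} (hA : MeasurableSet A)
    (x : IncrPath d) :
    ∫⁻ p in {p : ℝ × ℝ | p.2 ∈ A ∧ p.2 - p.1 ∈ D}, ‖W (x.inc p.1 p.2) (p.2 - p.1)‖ₑ
      ≤ η * volume A := by
  have hS : MeasurableSet {p : ℝ × ℝ | p.2 ∈ A ∧ p.2 - p.1 ∈ D} :=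
    (measurable_snd hA).inter ((measurable_snd.sub measurable_fst) hD)
  rw [← lintegral_indicator hS, Measure.volume_eq_prod,
    lintegral_prod_symm _ ((continuous_W_inc hW x).enorm.measurable.indicator hS).aemeasurable,
    ← setLIntegral_const, ← lintegral_indicator hA]
  refine lintegral_mono fun t => ?_
  by_cases ht : t ∈ A
  · rw [indicator_of_mem ht, ← lintegral_sub_left_eq_self _ t]
    let f : C(ℝ, E d) := ⟨fun r => -x.inc 0 (t - r),
      (continuous_inc continuous_const continuous_const (by fun_prop)).neg⟩
    refine le_trans (le_of_eq ?_) (hη f)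
    rw [← lintegral_indicator hD]
    refine lintegral_congr fun r => ?_
    have : f r - f 0 = x.inc (t - r) t := by
      simp only [f, ContinuousMap.coe_mk, sub_zero]
      rw [x.inc_eq_sub 0 (t - r) t]
      abel
    have hr : (t - r, t) ∈ {p : ℝ × ℝ | p.2 ∈ A ∧ p.2 - p.1 ∈ D} ↔ r ∈ D := by simp [ht]
    by_cases h : r ∈ D
    · rw [indicator_of_mem h, indicator_of_mem (hr.2 h), this, sub_sub_cancel]
    · rw [indicator_of_notMem h, indicator_of_notMem (mt hr.1 h)]
  · rw [indicator_of_notMem ht]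
    simp [indicator, ht]

end Strips

/-! ### Interaction between the past and the future -/

section Cross

/-- The change of the interaction between the time points `p.1 ≤ 0` and `p.2 ≥ 0` of the path `f`
when a time interval of length `c`, over which the path has increment `ξ`, is inserted at `0`,
compared to an insertion with zero increment. -/
def crossW (W : E d → ℝ → ℝ) (c : ℝ) (ξ : E d) (f : C(ℝ, E d)) (p : ℝ × ℝ) : ℝ :=
  W (ξ + (f p.2 - f p.1)) (c + p.2 - p.1) - W (f p.2 - f p.1) (c + p.2 - p.1)

/-- A uniform bound on the interaction between past and future, linear in the increment `ξ`. -/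
def CrossBound (W : E d → ℝ → ℝ) (C : ℝ≥0) : Prop :=
  ∀ (c : ℝ) (ξ : E d) (f : C(ℝ, E d)), 0 ≤ c →
    ∫⁻ p in Iic 0 ×ˢ Ici 0, ‖crossW W c ξ f p‖ₑ ≤ C * (1 + ‖ξ‖ₑ)

/-- The simultaneous reflection of space and time. -/
def spaceTimeReflect (W : E d → ℝ → ℝ) : E d → ℝ → ℝ := fun ξ t => W (-ξ) (-t)

variable {W : E d → ℝ → ℝ}

theorem continuous_reflect (hW : Continuous (Function.uncurry W)) :
    Continuous (Function.uncurry (reflect W)) :=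
  hW.comp (continuous_fst.prodMk continuous_snd.neg)

theorem continuous_crossW (hW : Continuous (Function.uncurry W)) (c : ℝ) (ξ : E d)
    (f : C(ℝ, E d)) : Continuous (crossW W c ξ f) :=
  (hW.comp (f := fun p : ℝ × ℝ => (ξ + (f p.2 - f p.1), c + p.2 - p.1)) (by fun_prop)).sub
    (hW.comp (f := fun p : ℝ × ℝ => (f p.2 - f p.1, c + p.2 - p.1)) (by fun_prop))

theorem exists_crossBound (hW : Continuous (Function.uncurry W)) (hH2 : H2 W) :
    ∃ C, CrossBound W C := by
  obtain ⟨C, hC⟩ := hH2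
  refine ⟨C, fun c ξ f hc => le_trans (le_of_eq ?_) ((le_iSup₂_of_le c hc
    (le_iSup (fun x : IncrPath d => Q W x ξ c) (ofFun (-f) (-f).continuous))).trans (hC ξ))⟩
  rw [Measure.volume_eq_prod, ← Measure.prod_restrict,
    lintegral_prod _ (continuous_crossW hW c ξ f).enorm.measurable.aemeasurable]
  simp only [Q, crossW, inc_ofFun, Pi.neg_apply, neg_sub_neg]

theorem CrossBound.spaceTimeReflect {C : ℝ≥0} (h : CrossBound (reflect W) C) :
    CrossBound (spaceTimeReflect W) C := by
  intro c ξ f hc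
  have := h c (-ξ) (-f) hc
  rw [enorm_neg] at this
  refine le_trans (le_of_eq (lintegral_congr fun p => ?_)) this
  simp only [crossW, BrownianIncrements.spaceTimeReflect, reflect, ContinuousMap.neg_apply]
  congr 3 <;> abel

/-- The far past and the far future interact little, uniformly in the path, for fixed `ξ`. -/
theorem CrossBound.exists_tail_le {C : ℝ≥0} (h : CrossBound W C) {c : ℝ} (hc : 0 ≤ c) (ξ : E d)
    {ε : ℝ≥0∞} (hε : 0 < ε) :
    ∃ n : ℕ, ∀ f : C(ℝ, E d),
      ∫⁻ p in Iic (-((n : ℝ) + 1)) ×ˢ Ici ((n : ℝ) + 1), ‖crossW W c ξ f p‖ₑ ≤ ε := by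
  have hmeasC : ∀ n : ℕ, MeasurableSet (Iic (-((n : ℝ) + 1)) ×ˢ Ici ((n : ℝ) + 1)) :=
    fun n => measurableSet_Iic.prod measurableSet_Ici
  obtain ⟨n, hn⟩ : ∃ n : ℕ, ∀ f : C(ℝ, E d),
      ∫⁻ p in Iic (-((n : ℝ) + 1)) ×ˢ Ici ((n : ℝ) + 1), ‖crossW W c ξ f p‖ₑ
        ∂(volume.restrict (Iic (0 : ℝ) ×ˢ Ici (0 : ℝ))) ≤ ε := by
    refine exists_uniform_tail (volume.restrict (Iic (0 : ℝ) ×ˢ Ici (0 : ℝ)))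
      (fun (f : C(ℝ, E d)) p => ‖crossW W c ξ f p‖ₑ)
      (fun n : ℕ => Icc (-(n : ℝ)) n ×ˢ Icc (-(n : ℝ)) n)
      (fun n : ℕ => Iic (-((n : ℝ) + 1)) ×ˢ Ici ((n : ℝ) + 1))
      (fun n => measurableSet_Icc.prod measurableSet_Icc) hmeasC
      ?_ ?_ ?_ ?_ (M := C * (1 + ‖ξ‖ₑ)) (by finiteness) (fun f => h c ξ f hc) hε
    · intro n m hnm p hp
      have : (n : ℝ) ≤ m := Nat.cast_le.2 hnm
      simp only [mem_prod, mem_Icc] at hp ⊢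
      refine ⟨⟨?_, ?_⟩, ?_, ?_⟩ <;> linarith [hp.1.1, hp.1.2, hp.2.1, hp.2.2]
    · refine eq_univ_of_forall fun p => ?_
      obtain ⟨n, hn⟩ := exists_nat_ge (max |p.1| |p.2|)
      have h1 := abs_le.1 ((le_max_left _ _).trans hn)
      have h2 := abs_le.1 ((le_max_right _ _).trans hn)
      exact mem_iUnion.2 ⟨n, h1, h2⟩
    · refine fun n => Set.disjoint_left.2 fun p hp hp' => ?_
      simp only [mem_prod, mem_Icc, mem_Iic, mem_Ici] at hp hp'
      linarith [hp.1.1, hp'.1]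
    · intro n f₀ f
      obtain ⟨g, hg₁, hg₂⟩ := exists_glue n f₀ f
      refine ⟨g, fun p hp => ?_, fun p hp => ?_⟩
      · simp only [crossW, hg₁ p.1 (abs_le.2 hp.1), hg₁ p.2 (abs_le.2 hp.2)]
      · have h1 : (n : ℝ) + 1 ≤ |p.1| := le_abs.2 (.inr (le_neg.2 hp.1))
        have h2 : (n : ℝ) + 1 ≤ |p.2| := le_abs.2 (.inl hp.2)
        simp only [crossW, hg₂ p.1 h1, hg₂ p.2 h2]
  refine ⟨n, fun f => le_trans (le_of_eq ?_) (hn f)⟩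
  rw [Measure.restrict_restrict (hmeasC n)]
  congr 2
  refine (inter_eq_left.2 fun p hp => ?_).symm
  simp only [mem_prod, mem_Iic, mem_Ici] at hp ⊢
  constructor <;> linarith [hp.1, hp.2, (Nat.cast_nonneg n : (0 : ℝ) ≤ n)]

/-- For a time before `[a,b]` and a time after it, the relative interaction is of the form
`crossW`, where the path `f` arises from `y` by cutting out `[a,b]`. -/
theorem exists_relW_eq_crossW {a b : ℝ} (hab : a ≤ b) (x y : IncrPath d) :
    ∃ f : C(ℝ, E d), ∀ p : ℝ × ℝ, p.1 ≤ 0 → 0 ≤ p.2 →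
      relW W a b x y (a + p.1, b + p.2) = crossW W (b - a) (x.inc a b) f p := by
  refine ⟨⟨fun r => y.inc b (b + max r 0) + y.inc a (a + min r 0),
    (continuous_inc continuous_const continuous_const (by fun_prop)).add
      (continuous_inc continuous_const continuous_const (by fun_prop))⟩, fun p h1 h2 => ?_⟩
  have key : ∀ z : IncrPath d, (splice a b z y).inc (a + p.1) (b + p.2) =
      z.inc a b + (y.inc b (b + p.2) - y.inc a (a + p.1)) := by
    intro z
    have e1 : a + p.1 ≤ a := by linarith
    have e2 : b ≤ b + p.2 := by linarith
    rw [inc_splice, min_eq_left (e1.trans hab), max_eq_left e1, min_eq_right e2, max_eq_right hab,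
      min_eq_left e1, min_eq_right (hab.trans e2), max_eq_right (e1.trans hab), max_eq_left e2,
      y.inc_swap a]
    abel
  simp only [relW, crossW, key, ContinuousMap.coe_mk, max_eq_left h2, min_eq_right h2,
    max_eq_right h1, min_eq_left h1, inc_zero, add_zero, inc_self, zero_add]
  have e : b + p.2 - (a + p.1) = b - a + p.2 - p.1 := by ring
  rw [e]

theorem relW_swap (a b : ℝ) (x y : IncrPath d) (p : ℝ × ℝ) :
    relW W a b x y p = relW (spaceTimeReflect W) a b x y p.swap := by
  simp only [relW, spaceTimeReflect, Prod.fst_swap, Prod.snd_swap, neg_sub, ← inc_swap]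

end Cross

/-! ### Bounds on the relative energy -/

section Relative

variable {W : E d → ℝ → ℝ}

theorem continuous_relW (hW : Continuous (Function.uncurry W)) (a b : ℝ) :
    Continuous fun q : (IncrPath d × IncrPath d) × (ℝ × ℝ) =>
      relW W a b q.1.1 q.1.2 q.2 := by
  have h : ∀ z : IncrPath d × IncrPath d → IncrPath d, Continuous z →
      Continuous fun q : (IncrPath d × IncrPath d) × (ℝ × ℝ) =>
        W ((splice a b (z q.1) q.1.2).inc q.2.1 q.2.2) (q.2.2 - q.2.1) := by
    intro z hz
    refine hW.comp (Continuous.prodMk (continuous_inc ?_ (by fun_prop) (by fun_prop))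
      (by fun_prop))
    exact (continuous_splice a b).comp
      ((hz.comp continuous_fst).prodMk (continuous_snd.comp continuous_fst))
  exact (h Prod.fst continuous_fst).sub (h (fun _ => 0) continuous_const)

theorem continuous_relW_time (hW : Continuous (Function.uncurry W)) (a b : ℝ) (x y : IncrPath d) :
    Continuous (relW W a b x y) :=
  (continuous_W_inc hW _).sub (continuous_W_inc hW _)

theorem relW_eq_zero {a b : ℝ} (hab : a ≤ b) (x y : IncrPath d) {p : ℝ × ℝ}
    (hp : (p.1 ≤ a ∧ p.2 ≤ a) ∨ (b ≤ p.1 ∧ b ≤ p.2)) : relW W a b x y p = 0 := by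
  rcases hp with h | h
  · simp only [relW, inc_splice_left hab h.1 h.2, sub_self]
  · simp only [relW, inc_splice_right hab h.1 h.2, sub_self]

theorem lintegral_relW_strip_le (hW : Continuous (Function.uncurry W)) {D : Set ℝ}
    (hD : MeasurableSet D) {η : ℝ≥0∞}
    (hη : ∀ f : C(ℝ, E d), ∫⁻ t in D, ‖W (f t - f 0) t‖ₑ ≤ η) {A : Set ℝ} (hA : MeasurableSet A)
    (a b : ℝ) (x y : IncrPath d) :
    ∫⁻ p in {p : ℝ × ℝ | p.1 ∈ A ∧ p.2 - p.1 ∈ D}, ‖relW W a b x y p‖ₑ ≤ 2 * (η * volume A) ∧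
      ∫⁻ p in {p : ℝ × ℝ | p.2 ∈ A ∧ p.2 - p.1 ∈ D}, ‖relW W a b x y p‖ₑ
        ≤ 2 * (η * volume A) := by
  have key : ∀ S : Set (ℝ × ℝ), ∫⁻ p in S, ‖relW W a b x y p‖ₑ ≤
      (∫⁻ p in S, ‖W ((splice a b x y).inc p.1 p.2) (p.2 - p.1)‖ₑ) +
        ∫⁻ p in S, ‖W ((splice a b 0 y).inc p.1 p.2) (p.2 - p.1)‖ₑ := by
    intro S
    rw [← lintegral_add_left (continuous_W_inc hW _).enorm.measurable]
    exact lintegral_mono fun p => enorm_sub_le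
  constructor
  · refine (key _).trans ?_
    rw [two_mul]
    exact add_le_add (lintegral_strip_fst_le hW hD hη hA _) (lintegral_strip_fst_le hW hD hη hA _)
  · refine (key _).trans ?_
    rw [two_mul]
    exact add_le_add (lintegral_strip_snd_le hW hD hη hA _) (lintegral_strip_snd_le hW hD hη hA _)

theorem lintegral_relW_cross_le {a b : ℝ} (hab : a ≤ b) {ξ : E d} {r : ℝ} (hr : 0 ≤ r) {η : ℝ≥0∞}
    (hη : ∀ f : C(ℝ, E d), ∫⁻ p in Iic (-r) ×ˢ Ici r, ‖crossW W (b - a) ξ f p‖ₑ ≤ η)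
    (x y : IncrPath d) (hx : x.inc a b = ξ) :
    ∫⁻ p in Iic (a - r) ×ˢ Ici (b + r), ‖relW W a b x y p‖ₑ ≤ η := by
  subst hx
  obtain ⟨f, hf⟩ := exists_relW_eq_crossW (W := W) hab x y
  refine le_trans (le_of_eq ?_) (hη f)
  rw [← lintegral_indicator (measurableSet_Iic.prod measurableSet_Ici),
    ← lintegral_indicator (measurableSet_Iic.prod measurableSet_Ici),
    ← lintegral_add_left_eq_self _ ((a, b) : ℝ × ℝ)]
  refine lintegral_congr fun p => ?_
  simp only [indicator, mem_prod, mem_Iic, mem_Ici, Prod.fst_add, Prod.snd_add]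
  have hiff : (a + p.1 ≤ a - r ∧ b + r ≤ b + p.2) ↔ (p.1 ≤ -r ∧ r ≤ p.2) := by
    constructor <;> rintro ⟨h1, h2⟩ <;> constructor <;> linarith
  by_cases h : p.1 ≤ -r ∧ r ≤ p.2
  · rw [if_pos (hiff.2 h), if_pos h, ← hf p (by linarith [h.1]) (hr.trans h.2)]
    rfl
  · rw [if_neg (fun h' => h (hiff.1 h')), if_neg h]

theorem lintegral_relW_cross_swap_le {a b : ℝ} (hab : a ≤ b) {ξ : E d} {r : ℝ} (hr : 0 ≤ r)
    {η : ℝ≥0∞}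
    (hη : ∀ f : C(ℝ, E d),
      ∫⁻ p in Iic (-r) ×ˢ Ici r, ‖crossW (spaceTimeReflect W) (b - a) ξ f p‖ₑ ≤ η)
    (x y : IncrPath d) (hx : x.inc a b = ξ) :
    ∫⁻ p in Ici (b + r) ×ˢ Iic (a - r), ‖relW W a b x y p‖ₑ ≤ η := by
  refine le_trans (le_of_eq ?_) (lintegral_relW_cross_le hab hr hη x y hx)
  have hmp : MeasurePreserving (Prod.swap : ℝ × ℝ → ℝ × ℝ) volume volume :=
    Measure.measurePreserving_swap
  have := hmp.setLIntegral_comp_preimage_emb MeasurableEquiv.prodComm.measurableEmbedding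
    (fun p => ‖relW (spaceTimeReflect W) a b x y p‖ₑ) (Iic (a - r) ×ˢ Ici (b + r))
  rw [← this, preimage_swap_prod]
  exact lintegral_congr fun p => by rw [relW_swap]

/-- A set integral of a nonnegative function is at most its sum over sets covering the support. -/
theorem setLIntegral_le_of_cover {α : Type*} [MeasurableSpace α] {m : Measure α} {f : α → ℝ≥0∞}
    {S A B C D : Set α} (hS : MeasurableSet S) (hA : MeasurableSet A) (hB : MeasurableSet B)
    (hC : MeasurableSet C) (hD : MeasurableSet D)
    (h : ∀ p ∈ S, p ∉ A → p ∉ B → p ∉ C → p ∉ D → f p = 0) :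
    ∫⁻ p in S, f p ∂m ≤ ∫⁻ p in A, f p ∂m + ∫⁻ p in B, f p ∂m +
      (∫⁻ p in C, f p ∂m + ∫⁻ p in D, f p ∂m) := by
  have h1 : ∫⁻ p in S, f p ∂m ≤ ∫⁻ p in (A ∪ B) ∪ (C ∪ D), f p ∂m := by
    rw [← lintegral_indicator hS, ← lintegral_indicator ((hA.union hB).union (hC.union hD))]
    refine lintegral_mono fun p => ?_
    by_cases hp : p ∈ (A ∪ B) ∪ (C ∪ D)
    · rw [indicator_of_mem hp]
      exact indicator_le_self _ _ p
    · by_cases hpS : p ∈ S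
      · simp only [mem_union, not_or] at hp
        rw [indicator_of_mem hpS, h p hpS hp.1.1 hp.1.2 hp.2.1 hp.2.2]
        exact zero_le
      · rw [indicator_of_notMem hpS]
        exact zero_le
  exact h1.trans ((lintegral_union_le _ _ _).trans
    (add_le_add (lintegral_union_le _ _ _) (lintegral_union_le _ _ _)))

/-- The square `[-R,R]²` in the time plane. -/
abbrev timeSquare (R : ℝ) : Set (ℝ × ℝ) := Icc (-R) R ×ˢ Icc (-R) R

theorem measurableSet_timeSquare (R : ℝ) : MeasurableSet (timeSquare R) :=
  measurableSet_Icc.prod measurableSet_Icc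

/-- The energies that enter the finite-volume measures are bounded, uniformly in the path. -/
theorem exists_lintegral_W_le (hW : Continuous (Function.uncurry W)) (hH1 : H1 W)
    (hH1' : H1 (reflect W)) (R : ℝ) :
    ∃ K : ℝ≥0, ∀ x : IncrPath d,
      ∫⁻ p in timeSquare R, ‖W (x.inc p.1 p.2) (p.2 - p.1)‖ₑ ≤ K := by
  obtain ⟨M, hM⟩ := exists_lintegral_le hH1 hH1'
  have hvol : volume (Icc (-R) R) ≠ ∞ := measure_Icc_lt_top.ne
  refine ⟨(M * volume (Icc (-R) R)).toNNReal, fun x => ?_⟩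
  rw [ENNReal.coe_toNNReal (ENNReal.mul_ne_top ENNReal.coe_ne_top hvol)]
  refine le_trans (lintegral_mono_set fun p hp => ?_)
    (lintegral_strip_fst_le hW MeasurableSet.univ (by simpa using hM) measurableSet_Icc x)
  exact ⟨hp.1, mem_univ _⟩

/-- The relative energy is bounded linearly in the increment `x_{ab}`, uniformly in `y`. -/
theorem exists_lintegral_relW_le (hW : Continuous (Function.uncurry W)) (hH1 : H1 W) (hH2 : H2 W)
    (hH1' : H1 (reflect W)) (hH2' : H2 (reflect W)) {a b : ℝ} (hab : a ≤ b) :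
    ∃ K : ℝ≥0, ∀ x y : IncrPath d,
      ∫⁻ p, ‖relW W a b x y p‖ₑ ≤ K * (1 + ‖x.inc a b‖ₑ) := by
  obtain ⟨M, hM⟩ := exists_lintegral_le hH1 hH1'
  obtain ⟨C, hC⟩ := exists_crossBound hW hH2
  obtain ⟨C', hC'⟩ := exists_crossBound (continuous_reflect hW) hH2'
  have hvol : volume (Icc a b) ≠ ∞ := measure_Icc_lt_top.ne
  set v : ℝ≥0 := 2 * (M * (volume (Icc a b)).toNNReal) with hv
  have hv' : (v : ℝ≥0∞) = 2 * (M * volume (Icc a b)) := by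
    simp [hv]
  refine ⟨v + v + (C + C'), fun x y => ?_⟩
  have hstrip := lintegral_relW_strip_le hW MeasurableSet.univ (by simpa using hM)
    (measurableSet_Icc (a := a) (b := b)) a b x y
  have hc1 := lintegral_relW_cross_le (W := W) hab le_rfl
    (fun f => by simpa using hC _ _ f (sub_nonneg.2 hab)) x y rfl
  have hc2 := lintegral_relW_cross_swap_le (W := W) hab le_rfl
    (fun f => by simpa using hC'.spaceTimeReflect _ _ f (sub_nonneg.2 hab)) x y rfl
  have hcov := setLIntegral_le_of_cover (m := volume) (f := fun p => ‖relW W a b x y p‖ₑ)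
    MeasurableSet.univ
    ((measurable_fst (measurableSet_Icc (a := a) (b := b))).inter
      ((measurable_snd.sub measurable_fst) MeasurableSet.univ))
    ((measurable_snd (measurableSet_Icc (a := a) (b := b))).inter
      ((measurable_snd.sub measurable_fst) MeasurableSet.univ))
    (measurableSet_Iic.prod measurableSet_Ici : MeasurableSet (Iic (a - 0) ×ˢ Ici (b + 0)))
    (measurableSet_Ici.prod measurableSet_Iic : MeasurableSet (Ici (b + 0) ×ˢ Iic (a - 0))) ?_
  · rw [setLIntegral_univ] at hcov
    refine hcov.trans ((add_le_add (add_le_add hstrip.1 hstrip.2) (add_le_add hc1 hc2)).trans ?_)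
    rw [← hv']
    push_cast
    have h1 : (v : ℝ≥0∞) ≤ v * (1 + ‖x.inc a b‖ₑ) := le_mul_of_one_le_right' le_self_add
    refine (add_le_add (add_le_add h1 h1) le_rfl).trans (le_of_eq ?_)
    ring
  · rintro ⟨s, t⟩ - hA hB hC hD
    simp only [mem_inter_iff, mem_preimage, mem_univ, and_true, mem_Icc, mem_prod, mem_Iic,
      mem_Ici, add_zero, sub_zero] at hA hB hC hD
    rw [relW_eq_zero hab, enorm_zero]
    grind

/-- For fixed `x`, the relative energy outside large squares is small, uniformly in `y`. -/
theorem exists_lintegral_relW_compl_le (hW : Continuous (Function.uncurry W)) (hH1 : H1 W)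
    (hH2 : H2 W) (hH1' : H1 (reflect W)) (hH2' : H2 (reflect W)) {a b : ℝ} (hab : a ≤ b)
    (x : IncrPath d) {ε : ℝ≥0∞} (hε : 0 < ε) :
    ∃ R₀ : ℝ, ∀ R, R₀ ≤ R → ∀ y : IncrPath d,
      ∫⁻ p in (timeSquare R)ᶜ, ‖relW W a b x y p‖ₑ ≤ ε := by
  obtain ⟨C, hC⟩ := exists_crossBound hW hH2
  obtain ⟨C', hC'⟩ := exists_crossBound (continuous_reflect hW) hH2'
  have hε4 : 0 < ε / 4 := ENNReal.div_pos hε.ne' (by simp)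
  obtain ⟨n, hn⟩ := hC.exists_tail_le (sub_nonneg.2 hab) (x.inc a b) hε4
  obtain ⟨m, hm⟩ := hC'.spaceTimeReflect.exists_tail_le (sub_nonneg.2 hab) (x.inc a b) hε4
  -- Beyond `L` the interaction between past and future is negligible.
  set L : ℝ := |a| + |b| + (n + 1) + (m + 1) with hL
  have hvol : 2 * volume (Icc (-L) L) ≠ ∞ := ENNReal.mul_ne_top (by simp) measure_Icc_lt_top.ne
  obtain ⟨k, hk⟩ := exists_lintegral_tail_le hH1 hH1' (ENNReal.div_pos hε4.ne' hvol)
  refine ⟨L + (k + 1), fun R hR y => ?_⟩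
  have hD : MeasurableSet {t : ℝ | (k : ℝ) + 1 ≤ |t|} :=
    measurableSet_le (by fun_prop) (by fun_prop)
  have hstrip := lintegral_relW_strip_le hW hD hk (measurableSet_Icc (a := -L) (b := L)) a b x y
  have hη : 2 * (ε / 4 / (2 * volume (Icc (-L) L)) * volume (Icc (-L) L)) ≤ ε / 4 := by
    calc 2 * (ε / 4 / (2 * volume (Icc (-L) L)) * volume (Icc (-L) L))
        = 2 * volume (Icc (-L) L) * (ε / 4 / (2 * volume (Icc (-L) L))) := by ring
      _ ≤ ε / 4 := ENNReal.mul_div_le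
  have hn0 : (0 : ℝ) ≤ n := Nat.cast_nonneg n
  have hm0 : (0 : ℝ) ≤ m := Nat.cast_nonneg m
  have hc1 := lintegral_relW_cross_le (W := W) hab (r := n + 1) (by linarith) hn x y rfl
  have hc2 := lintegral_relW_cross_swap_le (W := W) hab (r := m + 1) (by linarith) hm x y rfl
  have hcov := setLIntegral_le_of_cover (m := volume) (f := fun p => ‖relW W a b x y p‖ₑ)
    (measurableSet_timeSquare R).compl
    ((measurable_fst (measurableSet_Icc (a := -L) (b := L))).inter
      ((measurable_snd.sub measurable_fst) hD))
    ((measurable_snd (measurableSet_Icc (a := -L) (b := L))).inter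
      ((measurable_snd.sub measurable_fst) hD))
    (measurableSet_Iic.prod measurableSet_Ici :
      MeasurableSet (Iic (a - ((n : ℝ) + 1)) ×ˢ Ici (b + ((n : ℝ) + 1))))
    (measurableSet_Ici.prod measurableSet_Iic :
      MeasurableSet (Ici (b + ((m : ℝ) + 1)) ×ˢ Iic (a - ((m : ℝ) + 1)))) ?_
  · refine hcov.trans ((add_le_add (add_le_add (hstrip.1.trans hη) (hstrip.2.trans hη))
      (add_le_add hc1 hc2)).trans (le_of_eq ?_))
    calc ε / 4 + ε / 4 + (ε / 4 + ε / 4) = 4 * (ε / 4) := by ring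
      _ = ε := ENNReal.mul_div_cancel (by norm_num) (by norm_num)
  · rintro ⟨s, t⟩ hS hA hB hC hD
    have ha := neg_abs_le a
    have ha' := le_abs_self a
    have hb := neg_abs_le b
    have hb' := le_abs_self b
    have ha0 := abs_nonneg a
    have hb0 := abs_nonneg b
    have hk0 : (0 : ℝ) ≤ k := Nat.cast_nonneg k
    simp only [mem_compl_iff, mem_inter_iff, mem_preimage, mem_Icc, mem_prod, mem_Iic,
      mem_Ici, mem_ofPred_eq, le_abs, not_and_or, not_or, not_le, Pi.sub_apply] at hS hA hB hC hD
    rw [relW_eq_zero hab, enorm_zero]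
    grind

end Relative

/-! ### The resampling kernels -/

section Kernels

variable {W : E d → ℝ → ℝ} {a b : ℝ} {K : ℝ≥0} {μ : Measure (IncrPath d)}

/-- The linear bound on the relative energy on which the construction of the kernels rests. -/
def RelBound (W : E d → ℝ → ℝ) (a b : ℝ) (K : ℝ≥0) : Prop :=
  ∀ x y : IncrPath d, ∫⁻ p, ‖relW W a b x y p‖ₑ ≤ K * (1 + ‖x.inc a b‖ₑ)

/-- The relative energy of the region `S` of the time plane. For `S = univ` this is, up to an
additive constant, the energy `U_I(x) + V_I(x,y)` of the specification, while for `S = [-T,T]²` it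
is the corresponding energy for the finite-volume measure. -/
noncomputable def relEnergy (W : E d → ℝ → ℝ) (a b : ℝ) (S : Set (ℝ × ℝ)) (x y : IncrPath d) : ℝ :=
  ∫ p in S, relW W a b x y p

/-- The kernel which resamples the increments of `y` inside `[a,b]` with the Boltzmann weight of
the relative energy of the region `S`. -/
noncomputable def resample (W : E d → ℝ → ℝ) (μ : Measure (IncrPath d)) (lam a b : ℝ) (S : Set (ℝ × ℝ))
    (y : IncrPath d) : Measure (IncrPath d) :=
  (μ.tilted fun x => -lam * relEnergy W a b S x y).map fun x => splice a b x y

theorem integrable_relW (hW : Continuous (Function.uncurry W)) (hK : RelBound W a b K)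
    (x y : IncrPath d) : Integrable (relW W a b x y) :=
  ⟨(continuous_relW_time hW a b x y).aestronglyMeasurable,
    (hK x y).trans_lt (by finiteness)⟩

theorem abs_relEnergy_le (hK : RelBound W a b K) (S : Set (ℝ × ℝ)) (x y : IncrPath d) :
    |relEnergy W a b S x y| ≤ K * (1 + ‖x.inc a b‖) := by
  have h := (enorm_integral_le_lintegral_enorm (μ := volume.restrict S) (relW W a b x y)).trans
    ((setLIntegral_le_lintegral S _).trans (hK x y))
  have h2 := ENNReal.toReal_mono (by finiteness) h
  simpa [relEnergy, ENNReal.toReal_add] using h2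

theorem measurable_relEnergy (hW : Continuous (Function.uncurry W)) (a b : ℝ) (S : Set (ℝ × ℝ)) :
    Measurable fun q : IncrPath d × IncrPath d => relEnergy W a b S q.1 q.2 :=
  (StronglyMeasurable.integral_prod_right' (ν := volume.restrict S)
    (continuous_relW hW a b).stronglyMeasurable).measurable

theorem measurable_relEnergy_left (hW : Continuous (Function.uncurry W)) (a b : ℝ)
    (S : Set (ℝ × ℝ)) (y : IncrPath d) : Measurable fun x => relEnergy W a b S x y := by
  have h : Measurable fun x : IncrPath d => (x, y) := measurable_prodMk_right
  have h2 := (measurable_relEnergy hW a b S).comp h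
  exact h2

/-- The exponential envelope of all Boltzmann weights. -/
noncomputable def envelope (lam a b : ℝ) (K : ℝ≥0) (x : IncrPath d) : ℝ :=
  Real.exp (|lam| * (K * (1 + ‖x.inc a b‖)))

theorem envelope_pos (lam a b : ℝ) (K : ℝ≥0) (x : IncrPath d) : 0 < envelope lam a b K x :=
  Real.exp_pos _

theorem continuous_envelope (lam a b : ℝ) (K : ℝ≥0) :
    Continuous (envelope (d := d) lam a b K) := by
  have : Continuous fun x : IncrPath d => x.inc a b :=
    continuous_inc continuous_id continuous_const continuous_const
  unfold envelope
  fun_prop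

theorem integrable_envelope (hμ : IsBrownianIncrementLaw μ) (lam a b : ℝ) (K : ℝ≥0) :
    Integrable (envelope lam a b K) μ := by
  refine ((integrable_exp_norm_inc hμ a b (|lam| * K)).const_mul (Real.exp (|lam| * K))).congr
    (ae_of_all _ fun x => ?_)
  simp only [envelope, ← Real.exp_add]
  congr 1
  ring

theorem exp_relEnergy_le (hK : RelBound W a b K) (lam : ℝ) (S : Set (ℝ × ℝ)) (x y : IncrPath d) :
    Real.exp (-lam * relEnergy W a b S x y) ≤ envelope lam a b K x := by
  refine Real.exp_le_exp.2 ((le_abs_self _).trans ?_)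
  rw [abs_mul, abs_neg]
  exact mul_le_mul_of_nonneg_left (abs_relEnergy_le hK S x y) (abs_nonneg _)

theorem envelope_inv_le (hK : RelBound W a b K) (lam : ℝ) (S : Set (ℝ × ℝ)) (x y : IncrPath d) :
    (envelope lam a b K x)⁻¹ ≤ Real.exp (-lam * relEnergy W a b S x y) := by
  rw [envelope, ← Real.exp_neg]
  refine Real.exp_le_exp.2 (neg_le_of_abs_le ?_)
  rw [abs_mul, abs_neg]
  exact mul_le_mul_of_nonneg_left (abs_relEnergy_le hK S x y) (abs_nonneg _)

theorem integrable_exp_relEnergy (hμ : IsBrownianIncrementLaw μ)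
    (hW : Continuous (Function.uncurry W)) (hK : RelBound W a b K) (lam : ℝ) (S : Set (ℝ × ℝ))
    (y : IncrPath d) : Integrable (fun x => Real.exp (-lam * relEnergy W a b S x y)) μ := by
  refine (integrable_envelope hμ lam a b K).mono' ?_ (ae_of_all _ fun x => ?_)
  · exact (Real.measurable_exp.comp
      ((measurable_relEnergy_left hW a b S y).const_mul _)).aestronglyMeasurable
  · rw [Real.norm_of_nonneg (Real.exp_pos _).le]
    exact exp_relEnergy_le hK lam S x y

theorem integrable_envelope_inv (hμ : IsBrownianIncrementLaw μ) (lam a b : ℝ) (K : ℝ≥0) :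
    Integrable (fun x => (envelope lam a b K x)⁻¹) μ := by
  have := hμ.isProbabilityMeasure
  refine (integrable_const (1 : ℝ)).mono'
    (continuous_envelope lam a b K).measurable.inv.aestronglyMeasurable (ae_of_all _ fun x => ?_)
  rw [Real.norm_of_nonneg (inv_nonneg.2 (envelope_pos _ _ _ _ _).le)]
  exact inv_le_one_of_one_le₀ (Real.one_le_exp (by positivity))

theorem integral_envelope_inv_pos (hμ : IsBrownianIncrementLaw μ) (lam a b : ℝ) (K : ℝ≥0) :
    0 < ∫ x, (envelope lam a b K x)⁻¹ ∂μ := by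
  have := hμ.isProbabilityMeasure
  have h := integrable_envelope_inv hμ lam a b K
  refine (integral_pos_iff_support_of_nonneg
    (fun x => inv_nonneg.2 (envelope_pos lam a b K x).le) h).2 ?_
  have : Function.support (fun x : IncrPath d => (envelope lam a b K x)⁻¹) = univ :=
    eq_univ_of_forall fun x => inv_ne_zero (envelope_pos lam a b K x).ne'
  rw [this, measure_univ]
  exact one_pos

/-- The normalizing constants are bounded away from zero. -/
theorem integral_envelope_inv_le (hμ : IsBrownianIncrementLaw μ)
    (hW : Continuous (Function.uncurry W)) (hK : RelBound W a b K) (lam : ℝ) (S : Set (ℝ × ℝ))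
    (y : IncrPath d) :
    ∫ x, (envelope lam a b K x)⁻¹ ∂μ ≤ ∫ x, Real.exp (-lam * relEnergy W a b S x y) ∂μ :=
  integral_mono (integrable_envelope_inv hμ lam a b K)
    (integrable_exp_relEnergy hμ hW hK lam S y) fun x => envelope_inv_le hK lam S x y

theorem isProbabilityMeasure_resample (hμ : IsBrownianIncrementLaw μ)
    (hW : Continuous (Function.uncurry W)) (hK : RelBound W a b K) (lam : ℝ) (S : Set (ℝ × ℝ))
    (y : IncrPath d) : IsProbabilityMeasure (resample W μ lam a b S y) := by
  have := hμ.isProbabilityMeasure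
  have := isProbabilityMeasure_tilted (integrable_exp_relEnergy hμ hW hK lam S y)
  exact Measure.isProbabilityMeasure_map (continuous_splice_left a b y).measurable.aemeasurable

theorem relEnergy_splice (hab : a ≤ b) (S : Set (ℝ × ℝ)) (x y z : IncrPath d) :
    relEnergy W a b S x (splice a b z y) = relEnergy W a b S x y := by
  simp only [relEnergy, relW, splice_splice_right hab]

theorem resample_splice (hab : a ≤ b) (lam : ℝ) (S : Set (ℝ × ℝ)) (y z : IncrPath d) :
    resample W μ lam a b S (splice a b z y) = resample W μ lam a b S y := by
  simp only [resample, relEnergy_splice hab, splice_splice_right hab]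

theorem resample_apply (hW : Continuous (Function.uncurry W)) (lam : ℝ) (S : Set (ℝ × ℝ))
    (y : IncrPath d) {A : Set (IncrPath d)} (hA : MeasurableSet A) :
    resample W μ lam a b S y A =
      ENNReal.ofReal (∫ x, Real.exp (-lam * relEnergy W a b S x y) ∂μ)⁻¹ *
        ∫⁻ x, ENNReal.ofReal (Real.exp (-lam * relEnergy W a b S x y)) *
          A.indicator 1 (splice a b x y) ∂μ := by
  have hs := (continuous_splice_left a b y).measurable
  have hm : Measurable fun x => ENNReal.ofReal (Real.exp (-lam * relEnergy W a b S x y)) *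
      A.indicator 1 (splice a b x y) :=
    (Real.measurable_exp.comp
      ((measurable_relEnergy_left hW a b S y).const_mul _)).ennreal_ofReal.mul
      ((measurable_one.indicator hA).comp hs)
  rw [resample, ← lintegral_indicator_one hA, lintegral_map (measurable_one.indicator hA) hs,
    lintegral_tilted, ← lintegral_const_mul _ hm]
  refine lintegral_congr fun x => ?_
  rw [div_eq_inv_mul, ENNReal.ofReal_mul (by positivity), mul_assoc]

theorem measurable_resample (hμ : IsBrownianIncrementLaw μ)
    (hW : Continuous (Function.uncurry W)) (lam : ℝ) (S : Set (ℝ × ℝ)) :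
    Measurable (resample W μ lam a b S) := by
  have := hμ.isProbabilityMeasure
  refine Measure.measurable_of_measurable_coe _ fun A hA => ?_
  simp only [resample_apply hW lam S _ hA]
  have hexp : Measurable fun q : IncrPath d × IncrPath d =>
      Real.exp (-lam * relEnergy W a b S q.2 q.1) :=
    Real.measurable_exp.comp
      (((measurable_relEnergy hW a b S).comp measurable_swap).const_mul _)
  refine Measurable.mul ?_ ?_
  · exact (StronglyMeasurable.integral_prod_right'
      hexp.stronglyMeasurable).measurable.inv.ennreal_ofReal
  · exact Measurable.lintegral_prod_right' (hexp.ennreal_ofReal.mul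
      ((measurable_one.indicator hA).comp ((measurable_splice a b).comp measurable_swap)))

/-- The kernels of the specification are the resampling kernels of the whole time plane. -/
theorem spec_eq_resample (hW : Continuous (Function.uncurry W)) (hK : RelBound W a b K)
    (hab : a ≤ b) (lam : ℝ) (y : IncrPath d) :
    spec W μ lam a b y = resample W μ lam a b univ y := by
  have hcone : MeasurableSet (cone a b) :=
    ((((measurableSet_Ioi.prod measurableSet_Iio).union (measurableSet_Iio.prod
      measurableSet_Ioi)).union (measurableSet_Icc.prod measurableSet_Icc.compl)).union
      (measurableSet_Icc.compl.prod measurableSet_Icc))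
  have hint := fun x => integrable_relW hW hK x y
  have hWint : ∀ x : IncrPath d, IntegrableOn (fun p : ℝ × ℝ => W (x.inc p.1 p.2) (p.2 - p.1))
      (Icc a b ×ˢ Icc a b) := fun x =>
    (continuous_W_inc hW x).continuousOn.integrableOn_compact (isCompact_Icc.prod isCompact_Icc)
  have key : ∀ x : IncrPath d, U W a b x + V W a b x y = relEnergy W a b univ x y + U W a b 0 := by
    intro x
    have hdisj : Disjoint (Icc a b ×ˢ Icc a b) (cone a b) := by
      refine Set.disjoint_left.2 fun p hp hp' => ?_
      simp only [cone, mem_union, mem_prod, mem_Icc, mem_Ioi, mem_Iio, mem_compl_iff] at hp hp'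
      grind
    have h1 : relEnergy W a b univ x y =
        ∫ p in Icc a b ×ˢ Icc a b ∪ cone a b, relW W a b x y p := by
      rw [relEnergy, setIntegral_univ]
      refine (setIntegral_eq_integral_of_forall_compl_eq_zero fun p hp => ?_).symm
      refine relW_eq_zero hab x y ?_
      simp only [cone, mem_union, mem_prod, mem_Icc, mem_Ioi, mem_Iio, mem_compl_iff] at hp
      grind
    have h2 : ∫ p in Icc a b ×ˢ Icc a b, relW W a b x y p = U W a b x - U W a b 0 := by
      rw [U, U, ← integral_sub (hWint x) (hWint 0)]
      refine setIntegral_congr_fun (measurableSet_Icc.prod measurableSet_Icc) fun p hp => ?_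
      simp only [relW, inc_splice_inside hp.1 hp.2]
    rw [h1, setIntegral_union hdisj hcone (hint x).integrableOn (hint x).integrableOn, h2, V]
    ring
  have key2 : ∀ x : IncrPath d, -lam * U W a b x - lam * V W a b x y =
      -lam * relEnergy W a b univ x y + -lam * U W a b 0 := by
    intro x
    linear_combination (-lam) * key x
  simp only [spec, resample, Measure.tilted, key2, Real.exp_add, integral_mul_const]
  simp only [mul_div_mul_right _ _ (Real.exp_pos (-lam * U W a b 0)).ne']

end Kernels

/-! ### The finite-volume measures are invariant under resampling -/

section FiniteVolume

variable {W : E d → ℝ → ℝ} {a b : ℝ} {K : ℝ≥0} {μ : Measure (IncrPath d)}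

theorem H_eq_setIntegral (hW : Continuous (Function.uncurry W)) {T : ℝ} (hT : 0 ≤ T)
    (x : IncrPath d) : H W T x = ∫ p in timeSquare T, W (x.inc p.1 p.2) (p.2 - p.1) := by
  have hint : IntegrableOn (fun p : ℝ × ℝ => W (x.inc p.1 p.2) (p.2 - p.1)) (timeSquare T) :=
    (continuous_W_inc hW x).continuousOn.integrableOn_compact (isCompact_Icc.prod isCompact_Icc)
  have hTT : -T ≤ T := by linarith
  have hint' := hint
  rw [IntegrableOn, Measure.volume_eq_prod, ← Measure.prod_restrict] at hint'
  rw [Measure.volume_eq_prod, ← Measure.prod_restrict, integral_prod_symm _ hint', H]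
  simp only [intervalIntegral.integral_of_le hTT, integral_Icc_eq_integral_Ioc]

theorem H_splice (hW : Continuous (Function.uncurry W)) {T : ℝ} (hT : 0 ≤ T)
    (x y : IncrPath d) :
    H W T (splice a b x y) = H W T (splice a b 0 y) + relEnergy W a b (timeSquare T) x y := by
  have hint : ∀ z : IncrPath d,
      IntegrableOn (fun p : ℝ × ℝ => W (z.inc p.1 p.2) (p.2 - p.1)) (timeSquare T) := fun z =>
    (continuous_W_inc hW z).continuousOn.integrableOn_compact (isCompact_Icc.prod isCompact_Icc)
  rw [H_eq_setIntegral hW hT, H_eq_setIntegral hW hT, relEnergy, ← sub_eq_iff_eq_add',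
    ← integral_sub (hint _) (hint _)]
  rfl

theorem measurable_H (hW : Continuous (Function.uncurry W)) {T : ℝ} (hT : 0 ≤ T) :
    Measurable (H (d := d) W T) := by
  have h : Continuous fun q : IncrPath d × (ℝ × ℝ) =>
      W (q.1.inc q.2.1 q.2.2) (q.2.2 - q.2.1) :=
    hW.comp (continuous_inc_uncurry.prodMk (by fun_prop))
  have h2 := (StronglyMeasurable.integral_prod_right' (ν := volume.restrict (timeSquare T))
    h.stronglyMeasurable).measurable
  have : H (d := d) W T = fun x => ∫ p in timeSquare T, W (x.inc p.1 p.2) (p.2 - p.1) :=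
    funext fun x => H_eq_setIntegral hW hT x
  rw [this]
  exact h2

theorem integrable_exp_H (hμ : IsBrownianIncrementLaw μ) (hW : Continuous (Function.uncurry W))
    (hH1 : H1 W) (hH1' : H1 (reflect W)) (lam : ℝ) {T : ℝ} (hT : 0 ≤ T) :
    Integrable (fun x => Real.exp (-lam * H W T x)) μ := by
  have := hμ.isProbabilityMeasure
  obtain ⟨M, hM⟩ := exists_lintegral_W_le hW hH1 hH1' T
  refine (integrable_const (Real.exp (|lam| * M))).mono'
    (Real.measurable_exp.comp ((measurable_H hW hT).const_mul _)).aestronglyMeasurable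
    (ae_of_all _ fun x => ?_)
  rw [Real.norm_of_nonneg (Real.exp_pos _).le]
  refine Real.exp_le_exp.2 ((le_abs_self _).trans ?_)
  rw [abs_mul, abs_neg]
  refine mul_le_mul_of_nonneg_left ?_ (abs_nonneg _)
  rw [H_eq_setIntegral hW hT]
  have h := (enorm_integral_le_lintegral_enorm (μ := volume.restrict (timeSquare T))
    fun p : ℝ × ℝ => W (x.inc p.1 p.2) (p.2 - p.1)).trans (hM x)
  simpa using ENNReal.toReal_mono ENNReal.coe_ne_top h

theorem isProbabilityMeasure_finiteVolume (hμ : IsBrownianIncrementLaw μ)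
    (hW : Continuous (Function.uncurry W)) (hH1 : H1 W) (hH1' : H1 (reflect W)) (lam : ℝ) {T : ℝ}
    (hT : 0 ≤ T) : IsProbabilityMeasure (finiteVolume W μ lam T) := by
  have := hμ.isProbabilityMeasure
  exact isProbabilityMeasure_tilted (integrable_exp_H hμ hW hH1 hH1' lam hT)

/-- The finite-volume analogue of the DLR equation: the energy `H_T` of a path differs from the
energy of the path with its increments in `[a,b]` removed by the relative energy in `[-T,T]²`, so
under `μ_{λ,T}` the conditional law given the increments outside `[a,b]` is the corresponding
resampling kernel. -/
theorem bind_resample_finiteVolume (hμ : IsBrownianIncrementLaw μ)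
    (hW : Continuous (Function.uncurry W)) (hK : RelBound W a b K) (hab : a ≤ b) (lam : ℝ)
    {T : ℝ} (hT : 0 ≤ T) :
    (finiteVolume W μ lam T).bind (resample W μ lam a b (timeSquare T)) =
      finiteVolume W μ lam T := by
  have := hμ.isProbabilityMeasure
  set S := timeSquare T with hS
  have hR := measurable_resample (a := a) (b := b) hμ hW lam S
  refine Measure.ext fun A hA => ?_
  rw [Measure.bind_apply hA hR.aemeasurable, ← lintegral_indicator_one hA, finiteVolume,
    lintegral_tilted, lintegral_tilted]
  set ZT := ∫ x, Real.exp (-lam * H W T x) ∂μ with hZT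
  have hZT0 : 0 ≤ ZT := integral_nonneg fun x => (Real.exp_pos _).le
  have hmH : Measurable fun y => ENNReal.ofReal (Real.exp (-lam * H W T y) / ZT) :=
    ((Real.measurable_exp.comp ((measurable_H hW hT).const_mul _)).div_const _).ennreal_ofReal
  have hmA : Measurable fun y => resample W μ lam a b S y A := Measure.measurable_coe hA |>.comp hR
  have hexp : ∀ y, Measurable fun x => ENNReal.ofReal (Real.exp (-lam * relEnergy W a b S x y)) :=
    fun y => (Real.measurable_exp.comp
      ((measurable_relEnergy_left hW a b S y).const_mul _)).ennreal_ofReal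
  -- the weight of a spliced path factorizes
  have hfac : ∀ x y : IncrPath d, ENNReal.ofReal (Real.exp (-lam * H W T (splice a b x y)) / ZT) =
      ENNReal.ofReal (Real.exp (-lam * H W T (splice a b 0 y)) / ZT) *
        ENNReal.ofReal (Real.exp (-lam * relEnergy W a b S x y)) := by
    intro x y
    rw [H_splice hW hT, ← ENNReal.ofReal_mul (by positivity), mul_add, Real.exp_add]
    congr 1
    ring
  have hsplit : ∀ F : IncrPath d → ℝ≥0∞, Measurable F →
      ∫⁻ y, F y ∂μ = ∫⁻ y, ∫⁻ x, F (splice a b x y) ∂μ ∂μ := by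
    intro F hF
    conv_lhs => rw [← map_splice_prod hμ hab, lintegral_map hF (measurable_splice a b)]
    exact lintegral_prod_symm' _ (hF.comp (measurable_splice a b))
  have hm₁ : Measurable fun y => ENNReal.ofReal (Real.exp (-lam * H W T y) / ZT) *
      resample W μ lam a b S y A := hmH.mul hmA
  have hm₂ : Measurable fun y => ENNReal.ofReal (Real.exp (-lam * H W T y) / ZT) *
      A.indicator 1 y := hmH.mul (measurable_one.indicator hA)
  rw [hsplit _ hm₁, hsplit _ hm₂]
  refine lintegral_congr fun y => ?_
  have hZ : 0 < ∫ x, Real.exp (-lam * relEnergy W a b S x y) ∂μ :=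
    (integral_envelope_inv_pos hμ lam a b K).trans_le (integral_envelope_inv_le hμ hW hK lam S y)
  have hZ' : ∫⁻ x, ENNReal.ofReal (Real.exp (-lam * relEnergy W a b S x y)) ∂μ =
      ENNReal.ofReal (∫ x, Real.exp (-lam * relEnergy W a b S x y) ∂μ) :=
    (ofReal_integral_eq_lintegral_ofReal (integrable_exp_relEnergy hμ hW hK lam S y)
      (ae_of_all _ fun x => (Real.exp_pos _).le)).symm
  set c := ENNReal.ofReal (Real.exp (-lam * H W T (splice a b 0 y)) / ZT) with hc
  have e₁ : ∀ x, ENNReal.ofReal (Real.exp (-lam * H W T (splice a b x y)) / ZT) *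
      resample W μ lam a b S (splice a b x y) A =
      c * (ENNReal.ofReal (Real.exp (-lam * relEnergy W a b S x y)) *
        resample W μ lam a b S y A) := fun x => by
    rw [hfac x y, resample_splice hab, mul_assoc]
  have e₂ : ∀ x, ENNReal.ofReal (Real.exp (-lam * H W T (splice a b x y)) / ZT) *
      A.indicator 1 (splice a b x y) =
      c * (ENNReal.ofReal (Real.exp (-lam * relEnergy W a b S x y)) *
        A.indicator 1 (splice a b x y)) := fun x => by
    rw [hfac x y, mul_assoc]
  rw [lintegral_congr e₁, lintegral_congr e₂]
  have hm₃ : Measurable fun x => ENNReal.ofReal (Real.exp (-lam * relEnergy W a b S x y)) *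
      A.indicator 1 (splice a b x y) :=
    (hexp y).mul ((measurable_one.indicator hA).comp (continuous_splice_left a b y).measurable)
  rw [lintegral_const_mul _ ((hexp y).mul_const _), lintegral_mul_const _ (hexp y), hZ',
    resample_apply hW lam S y hA, ← mul_assoc (ENNReal.ofReal (∫ x, _ ∂μ)),
    ← ENNReal.ofReal_mul hZ.le, mul_inv_cancel₀ hZ.ne', ENNReal.ofReal_one, one_mul,
    lintegral_const_mul _ hm₃]

end FiniteVolume

/-! ### Compactness in the path space and tightness -/

/-- The path `x` with all increments outside the window `[-N,N]` removed. -/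
def window (N : ℕ) (x : IncrPath d) : IncrPath d := splice (-N) N x 0

theorem neg_cast_le (N : ℕ) : (-N : ℝ) ≤ N := by
  have : (0 : ℝ) ≤ N := Nat.cast_nonneg N
  linarith

theorem continuous_window (N : ℕ) : Continuous (window (d := d) N) :=
  continuous_splice_left _ _ 0

theorem inc_window (N : ℕ) (x : IncrPath d) {s t : ℝ} (hs : s ∈ Icc (-N : ℝ) N)
    (ht : t ∈ Icc (-N : ℝ) N) : (window N x).inc s t = x.inc s t :=
  inc_splice_inside hs ht

theorem window_congr (N : ℕ) {x y : IncrPath d}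
    (h : ∀ s ∈ Icc (-N : ℝ) N, ∀ t ∈ Icc (-N : ℝ) N, x.inc s t = y.inc s t) :
    window N x = window N y :=
  splice_congr (neg_cast_le N) h (fun _ _ _ _ => rfl) fun _ _ _ _ => rfl

theorem exists_subset_timeSquare {s : Set (ℝ × ℝ)} (hs : IsCompact s) :
    ∃ N₀ : ℕ, ∀ N : ℕ, N₀ ≤ N → s ⊆ timeSquare N := by
  obtain ⟨R, hR⟩ := hs.isBounded.exists_norm_le
  obtain ⟨N₀, hN₀⟩ := exists_nat_ge R
  refine ⟨N₀, fun N hN p hp => ?_⟩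
  have h := (hR p hp).trans (hN₀.trans (Nat.cast_le.2 hN))
  exact ⟨abs_le.1 ((norm_fst_le p).trans h), abs_le.1 ((norm_snd_le p).trans h)⟩

theorem restrict_window {s : Set (ℝ × ℝ)} {N : ℕ} (hs : s ⊆ timeSquare N) (x : IncrPath d) :
    (window N x).1.restrict s = (x.1 : C(ℝ × ℝ, E d)).restrict s := by
  ext1 p
  exact inc_window N x (hs p.2).1 (hs p.2).2

/-- Convergence in the path space is convergence of all windows. -/
theorem exists_tendsto_of_tendsto_window {ι : Type*} {l : Filter ι} [l.NeBot]
    {x : ι → IncrPath d} (h : ∀ N : ℕ, ∃ z, Tendsto (fun i => window N (x i)) l (nhds z)) :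
    ∃ z, Tendsto x l (nhds z) := by
  obtain ⟨g, hg⟩ := (ContinuousMap.exists_tendsto_compactOpen_iff_forall
    fun i => ((x i).1 : C(ℝ × ℝ, E d))).2 fun s hs => by
      obtain ⟨N, hN⟩ := exists_subset_timeSquare hs
      obtain ⟨z, hz⟩ := h N
      refine ⟨(z.1 : C(ℝ × ℝ, E d)).restrict s, ?_⟩
      have := ((ContinuousMap.continuous_restrict s).tendsto _).comp
        ((continuous_val.tendsto z).comp hz)
      refine this.congr fun i => ?_
      exact restrict_window (hN N le_rfl) (x i)
  have hmem : g ∈ (incrementSubmodule d : Set C(ℝ × ℝ, E d)) :=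
    isClosed_incrementSubmodule.mem_of_tendsto hg (Eventually.of_forall fun i => (x i).2)
  exact ⟨⟨g, hmem⟩, tendsto_subtype_rng.2 hg⟩

theorem tendsto_window (x : IncrPath d) :
    Tendsto (fun N : ℕ => window N x) atTop (nhds x) := by
  refine tendsto_subtype_rng.2 (ContinuousMap.tendsto_compactOpen_iff_forall _ _ |>.2
    fun s hs => ?_)
  obtain ⟨N₀, hN₀⟩ := exists_subset_timeSquare hs
  refine tendsto_const_nhds.congr' ?_
  filter_upwards [eventually_ge_atTop N₀] with N hN
  exact (restrict_window (hN₀ N hN) x).symm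

theorem isCompact_iInter_window {K : ℕ → Set (IncrPath d)} (hK : ∀ N, IsCompact (K N)) :
    IsCompact (⋂ N, window N ⁻¹' K N) := by
  rw [isCompact_iff_ultrafilter_le_nhds]
  intro l hl
  have hlK : ∀ N, window N ⁻¹' K N ∈ l := fun N =>
    mem_of_superset (le_principal_iff.1 hl) (iInter_subset _ N)
  obtain ⟨z, hz⟩ := exists_tendsto_of_tendsto_window (l := (l : Filter (IncrPath d)))
    (x := id) fun N => by
      obtain ⟨z, -, hz⟩ := isCompact_iff_ultrafilter_le_nhds.1 (hK N) (l.map (window N))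
        (le_principal_iff.2 (hlK N))
      exact ⟨z, hz⟩
  have hcl : IsClosed (⋂ N, window N ⁻¹' K N) :=
    isClosed_iInter fun N => (hK N).isClosed.preimage (continuous_window N)
  exact ⟨z, hcl.mem_of_tendsto hz (le_principal_iff.1 hl), hz⟩

/-- A family of measures is tight if each of its window marginals is dominated by a single finite
measure. -/
theorem isTightMeasureSet_of_window_le {M : Set (Measure (IncrPath d))}
    (κ : ℕ → Measure (IncrPath d)) [∀ N, IsFiniteMeasure (κ N)]
    (h : ∀ ρ ∈ M, ∀ N B, MeasurableSet B → ρ (window N ⁻¹' B) ≤ κ N (window N ⁻¹' B)) :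
    IsTightMeasureSet M := by
  rw [isTightMeasureSet_iff_exists_isCompact_measure_compl_le]
  intro ε hε
  obtain ⟨δ, hδ, hsum⟩ := ENNReal.exists_pos_sum_of_countable' hε.ne' ℕ
  have hex : ∀ N, ∃ K, IsCompact K ∧ κ N (window N ⁻¹' Kᶜ) ≤ δ N := by
    intro N
    obtain ⟨K, hK, hKδ⟩ := isTightMeasureSet_iff_exists_isCompact_measure_compl_le.1
      (isTightMeasureSet_singleton (μ := (κ N).map (window N))) (δ N) (hδ N)
    refine ⟨K, hK, le_trans (le_of_eq ?_) (hKδ _ rfl)⟩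
    rw [Measure.map_apply (continuous_window N).measurable hK.isClosed.measurableSet.compl]
  choose K hK hKδ using hex
  refine ⟨⋂ N, window N ⁻¹' K N, isCompact_iInter_window hK, fun ρ hρ => ?_⟩
  rw [compl_iInter]
  refine (measure_iUnion_le _).trans ((ENNReal.tsum_le_tsum fun N => ?_).trans hsum.le)
  rw [← preimage_compl]
  exact (h ρ hρ N _ (hK N).isClosed.measurableSet.compl).trans (hKδ N)

section Tight

variable {W : E d → ℝ → ℝ} {a b : ℝ} {K : ℝ≥0} {μ : Measure (IncrPath d)}

/-- A measure that dominates the law of the path inside `[a,b]` under all resampling kernels. -/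
noncomputable def dominating (μ : Measure (IncrPath d)) (lam a b : ℝ) (K : ℝ≥0) :
    Measure (IncrPath d) :=
  ENNReal.ofReal (∫ x, (envelope lam a b K x)⁻¹ ∂μ)⁻¹ •
    μ.withDensity fun x => ENNReal.ofReal (envelope lam a b K x)

theorem isFiniteMeasure_dominating (hμ : IsBrownianIncrementLaw μ) (lam a b : ℝ) (K : ℝ≥0) :
    IsFiniteMeasure (dominating μ lam a b K) := by
  have := isFiniteMeasure_withDensity_ofReal (integrable_envelope hμ lam a b K).2
  exact Measure.smul_finite _ ENNReal.ofReal_ne_top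

theorem resample_preimage_inner_le (hμ : IsBrownianIncrementLaw μ)
    (hW : Continuous (Function.uncurry W)) (hK : RelBound W a b K) (hab : a ≤ b) (lam : ℝ)
    (S : Set (ℝ × ℝ)) (y : IncrPath d) {B : Set (IncrPath d)} (hB : MeasurableSet B) :
    resample W μ lam a b S y ((fun x => splice a b x 0) ⁻¹' B) ≤
      dominating μ lam a b K ((fun x => splice a b x 0) ⁻¹' B) := by
  have hA : MeasurableSet ((fun x : IncrPath d => splice a b x 0) ⁻¹' B) :=
    (continuous_splice_left a b 0).measurable hB
  rw [resample_apply hW lam S y hA, dominating, Measure.smul_apply, smul_eq_mul,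
    withDensity_apply _ hA, ← lintegral_indicator hA]
  refine mul_le_mul' (ENNReal.ofReal_le_ofReal ?_) (lintegral_mono fun x => ?_)
  · exact inv_anti₀ (integral_envelope_inv_pos hμ lam a b K)
      (integral_envelope_inv_le hμ hW hK lam S y)
  · by_cases hx : splice a b x 0 ∈ B
    · rw [indicator_of_mem, indicator_of_mem, Pi.one_apply, mul_one]
      · exact ENNReal.ofReal_le_ofReal (exp_relEnergy_le hK lam S x y)
      · exact hx
      · simpa only [mem_preimage, splice_splice_left hab] using hx
    · rw [indicator_of_notMem, mul_zero]
      · exact zero_le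
      · simpa only [mem_preimage, splice_splice_left hab] using hx

theorem isTightMeasureSet_finiteVolume (hμ : IsBrownianIncrementLaw μ)
    (hW : Continuous (Function.uncurry W)) (hH1 : H1 W) (hH2 : H2 W) (hH1' : H1 (reflect W))
    (hH2' : H2 (reflect W)) (lam : ℝ) : IsTightMeasureSet (finiteVolume W μ lam '' Ici 1) := by
  choose K hK using fun N : ℕ =>
    exists_lintegral_relW_le hW hH1 hH2 hH1' hH2' (neg_cast_le N)
  have := fun N : ℕ => isFiniteMeasure_dominating hμ lam (-N) N (K N)
  refine isTightMeasureSet_of_window_le (fun N => dominating μ lam (-N) N (K N)) ?_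
  rintro _ ⟨T, hT, rfl⟩ N B hB
  have hT0 : (0 : ℝ) ≤ T := zero_le_one.trans hT
  have := isProbabilityMeasure_finiteVolume hμ hW hH1 hH1' lam hT0
  have hA : MeasurableSet (window N ⁻¹' B) := (continuous_window (d := d) N).measurable hB
  rw [← bind_resample_finiteVolume hμ hW (hK N) (neg_cast_le N) lam hT0,
    Measure.bind_apply hA (measurable_resample hμ hW lam _).aemeasurable]
  refine (lintegral_mono fun y =>
    resample_preimage_inner_le hμ hW (hK N) (neg_cast_le N) lam _ y hB).trans ?_
  rw [lintegral_const, measure_univ, mul_one]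
  rfl

end Tight

/-! ### Quasilocality of the specification -/

section Quasilocal

variable {W : E d → ℝ → ℝ} {a b : ℝ} {K : ℝ≥0} {μ : Measure (IncrPath d)}

theorem integral_resample {f : IncrPath d → ℝ} (hf : Measurable f) (lam : ℝ) (S : Set (ℝ × ℝ))
    (y : IncrPath d) :
    ∫ x, f x ∂(resample W μ lam a b S y) =
      (∫ x, Real.exp (-lam * relEnergy W a b S x y) * f (splice a b x y) ∂μ) /
        ∫ x, Real.exp (-lam * relEnergy W a b S x y) ∂μ := by
  rw [resample, integral_map (continuous_splice_left a b y).measurable.aemeasurable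
    hf.aestronglyMeasurable, integral_tilted, ← integral_div]
  refine integral_congr_ae (ae_of_all _ fun x => ?_)
  simp only [smul_eq_mul]
  ring

theorem integrable_exp_relEnergy_mul (hμ : IsBrownianIncrementLaw μ)
    (hW : Continuous (Function.uncurry W)) (hK : RelBound W a b K) {f : IncrPath d → ℝ}
    (hf : Measurable f) {B : ℝ} (hB : ∀ x, |f x| ≤ B) (lam : ℝ) (S : Set (ℝ × ℝ))
    (y : IncrPath d) :
    Integrable (fun x => Real.exp (-lam * relEnergy W a b S x y) * f (splice a b x y)) μ :=
  (integrable_exp_relEnergy hμ hW hK lam S y).mul_bdd (c := B)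
    (hf.comp (continuous_splice_left a b y).measurable).aestronglyMeasurable
    (ae_of_all _ fun _ => hB _)

/-- For fixed `x`, the energy of a large square approximates the full relative energy, uniformly in
the boundary condition. -/
theorem exists_abs_relEnergy_sub_le (hW : Continuous (Function.uncurry W)) (hH1 : H1 W)
    (hH2 : H2 W) (hH1' : H1 (reflect W)) (hH2' : H2 (reflect W)) (hK : RelBound W a b K)
    (hab : a ≤ b) (x : IncrPath d) {ε : ℝ} (hε : 0 < ε) :
    ∃ R₀ : ℝ, ∀ R, R₀ ≤ R → ∀ y : IncrPath d,
      |relEnergy W a b (timeSquare R) x y - relEnergy W a b univ x y| ≤ ε := by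
  obtain ⟨R₀, hR₀⟩ := exists_lintegral_relW_compl_le hW hH1 hH2 hH1' hH2' hab x
    (ENNReal.ofReal_pos.2 hε)
  refine ⟨R₀, fun R hR y => ?_⟩
  have hint := integrable_relW hW hK x y
  have h1 : relEnergy W a b (timeSquare R) x y - relEnergy W a b univ x y =
      -∫ p in (timeSquare R)ᶜ, relW W a b x y p := by
    rw [relEnergy, relEnergy, setIntegral_univ,
      ← integral_add_compl (measurableSet_timeSquare R) hint]
    ring
  rw [h1, abs_neg]
  have h2 := (enorm_integral_le_lintegral_enorm (μ := volume.restrict (timeSquare R)ᶜ)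
    (relW W a b x y)).trans (hR₀ R hR y)
  have h3 := ENNReal.toReal_mono ENNReal.ofReal_ne_top h2
  rwa [ENNReal.toReal_ofReal hε.le, toReal_enorm, Real.norm_eq_abs] at h3

/-- The specification is quasilocal: its kernels are uniformly approximated by the kernels which
only see a large window of the boundary condition. Along any sequences of windows and boundary
conditions this is dominated convergence. -/
theorem exists_abs_integral_resample_sub_le (hμ : IsBrownianIncrementLaw μ)
    (hW : Continuous (Function.uncurry W)) (hH1 : H1 W)
    (hH2 : H2 W) (hH1' : H1 (reflect W)) (hH2' : H2 (reflect W)) (hK : RelBound W a b K)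
    (hab : a ≤ b) (lam : ℝ) {f : IncrPath d → ℝ} (hf : Measurable f) {B : ℝ}
    (hB : ∀ x, |f x| ≤ B) {ε : ℝ} (hε : 0 < ε) :
    ∃ R₀ : ℝ, ∀ R, R₀ ≤ R → ∀ y : IncrPath d,
      |∫ x, f x ∂(resample W μ lam a b (timeSquare R) y) -
        ∫ x, f x ∂(resample W μ lam a b univ y)| ≤ ε := by
  by_contra! hcon
  choose R hR y hy using fun n : ℕ => hcon n
  set g : ℕ → IncrPath d → ℝ := fun n x =>
    Real.exp (-lam * relEnergy W a b (timeSquare (R n)) x (y n)) with hg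
  set g' : ℕ → IncrPath d → ℝ := fun n x =>
    Real.exp (-lam * relEnergy W a b univ x (y n)) with hg'
  have hgi : ∀ n, Integrable (g n) μ := fun n => integrable_exp_relEnergy hμ hW hK lam _ _
  have hgi' : ∀ n, Integrable (g' n) μ := fun n => integrable_exp_relEnergy hμ hW hK lam _ _
  -- the weights converge in `L¹(μ)`
  have hlim : Tendsto (fun n => ∫ x, |g n x - g' n x| ∂μ) atTop (nhds 0) := by
    have h0 : (0 : ℝ) = ∫ _, (0 : ℝ) ∂μ := by simp
    rw [h0]
    refine tendsto_integral_of_dominated_convergence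
      (fun x => envelope lam a b K x + envelope lam a b K x)
      (fun n => ((hgi n).sub (hgi' n)).abs.aestronglyMeasurable)
      ((integrable_envelope hμ lam a b K).add (integrable_envelope hμ lam a b K))
      (fun n => ae_of_all _ fun x => ?_) (ae_of_all _ fun x => ?_)
    · rw [Real.norm_eq_abs, abs_abs]
      refine (abs_sub _ _).trans (add_le_add ?_ ?_)
      · rw [abs_of_pos (Real.exp_pos _)]
        exact exp_relEnergy_le hK lam _ _ _
      · rw [abs_of_pos (Real.exp_pos _)]
        exact exp_relEnergy_le hK lam _ _ _
    · have hdiff : Tendsto (fun n => relEnergy W a b (timeSquare (R n)) x (y n) -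
          relEnergy W a b univ x (y n)) atTop (nhds 0) := by
        rw [Metric.tendsto_atTop]
        intro η hη
        obtain ⟨R₀, hR₀⟩ := exists_abs_relEnergy_sub_le hW hH1 hH2 hH1' hH2' hK hab x (half_pos hη)
        obtain ⟨n₀, hn₀⟩ := exists_nat_ge R₀
        refine ⟨n₀, fun n hn => ?_⟩
        rw [Real.dist_eq, sub_zero]
        exact (hR₀ (R n) (hn₀.trans ((Nat.cast_le.2 hn).trans (hR n))) (y n)).trans_lt
          (half_lt_self hη)
      have h1 : Tendsto (fun n => envelope lam a b K x * |Real.exp (-lam *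
          (relEnergy W a b (timeSquare (R n)) x (y n) - relEnergy W a b univ x (y n))) - 1|)
          atTop (nhds 0) := by
        have := ((((Real.continuous_exp.tendsto _).comp (hdiff.const_mul (-lam))).sub_const
          1).abs).const_mul (envelope lam a b K x)
        simpa [Function.comp_def] using this
      refine squeeze_zero (fun n => abs_nonneg _) (fun n => ?_) h1
      have h2 : g n x - g' n x = g' n x * (Real.exp (-lam *
          (relEnergy W a b (timeSquare (R n)) x (y n) - relEnergy W a b univ x (y n))) - 1) := by
        simp only [hg, hg', mul_sub, ← Real.exp_add, mul_one]
        congr 2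
        ring
      rw [h2, abs_mul, abs_of_pos (Real.exp_pos _)]
      exact mul_le_mul_of_nonneg_right (exp_relEnergy_le hK lam _ _ _) (abs_nonneg _)
  set z := ∫ x, (envelope lam a b K x)⁻¹ ∂μ with hz
  have hz0 : 0 < z := integral_envelope_inv_pos hμ lam a b K
  have hB0 : 0 ≤ B := (abs_nonneg _).trans (hB 0)
  have hbound : ∀ n, ε ≤ 2 * B / z * ∫ x, |g n x - g' n x| ∂μ := by
    intro n
    refine (hy n).le.trans ?_
    have hP := isProbabilityMeasure_resample hμ hW hK lam univ (y n)
    have hr : |∫ x, f x ∂(resample W μ lam a b univ (y n))| ≤ B := by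
      have := norm_integral_le_of_norm_le_const (μ := resample W μ lam a b univ (y n))
        (f := f) (C := B) (ae_of_all _ fun x => hB x)
      simpa using this
    rw [integral_resample hf] at hr
    rw [integral_resample hf, integral_resample hf]
    set N := ∫ x, Real.exp (-lam * relEnergy W a b (timeSquare (R n)) x (y n)) *
      f (splice a b x (y n)) ∂μ with hN
    set N' := ∫ x, Real.exp (-lam * relEnergy W a b univ x (y n)) *
      f (splice a b x (y n)) ∂μ with hN'
    set Z := ∫ x, Real.exp (-lam * relEnergy W a b (timeSquare (R n)) x (y n)) ∂μ with hZ
    set Z' := ∫ x, Real.exp (-lam * relEnergy W a b univ x (y n)) ∂μ with hZ'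
    have hzZ : z ≤ Z := integral_envelope_inv_le hμ hW hK lam _ _
    have hzZ' : z ≤ Z' := integral_envelope_inv_le hμ hW hK lam _ _
    have hZ0 : 0 < Z := hz0.trans_le hzZ
    have hZ0' : 0 < Z' := hz0.trans_le hzZ'
    set I := ∫ x, |g n x - g' n x| ∂μ with hI
    have hI0 : 0 ≤ I := integral_nonneg fun x => abs_nonneg _
    have hZZ : |Z' - Z| ≤ I := by
      rw [abs_sub_comm, hZ, hZ', ← integral_sub (hgi n) (hgi' n)]
      exact abs_integral_le_integral_abs
    have hNN : |N - N'| ≤ B * I := by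
      rw [hN, hN', ← integral_sub (integrable_exp_relEnergy_mul hμ hW hK hf hB lam _ _)
        (integrable_exp_relEnergy_mul hμ hW hK hf hB lam _ _), hI, ← integral_const_mul]
      refine abs_integral_le_integral_abs.trans (integral_mono_of_nonneg
        (ae_of_all _ fun x => abs_nonneg _) (((hgi n).sub (hgi' n)).abs.const_mul B)
        (ae_of_all _ fun x => ?_))
      simp only
      rw [← sub_mul, abs_mul, mul_comm]
      exact mul_le_mul_of_nonneg_right (hB _) (abs_nonneg _)
    have hid : N / Z - N' / Z' = ((N - N') + N' / Z' * (Z' - Z)) / Z := by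
      field_simp
      ring
    rw [hid, abs_div, abs_of_pos hZ0]
    have hnum : |(N - N') + N' / Z' * (Z' - Z)| ≤ 2 * B * I := by
      refine (abs_add_le _ _).trans ?_
      rw [abs_mul]
      have := mul_le_mul hr hZZ (abs_nonneg _) hB0
      linarith
    calc |(N - N') + N' / Z' * (Z' - Z)| / Z ≤ 2 * B * I / z :=
          div_le_div₀ (by positivity) hnum hz0 hzZ
      _ = 2 * B / z * I := by ring
  have := ge_of_tendsto' (hlim.const_mul (2 * B / z)) hbound
  rw [mul_zero] at this
  exact absurd this (not_le.2 hε)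

theorem continuous_relEnergy_timeSquare (hW : Continuous (Function.uncurry W)) (a b R : ℝ)
    (x : IncrPath d) : Continuous fun y => relEnergy W a b (timeSquare R) x y := by
  rw [continuous_iff_seqContinuous]
  intro u y hu
  have hcpt : IsCompact (insert y (range u) ×ˢ timeSquare R) :=
    hu.isCompact_insert_range.prod (isCompact_Icc.prod isCompact_Icc)
  have hcont : Continuous fun q : IncrPath d × (ℝ × ℝ) => relW W a b x q.1 q.2 := by
    have h : Continuous fun q : IncrPath d × (ℝ × ℝ) => ((x, q.1), q.2) := by fun_prop
    have h2 := (continuous_relW hW a b).comp h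
    exact h2
  obtain ⟨C, hC⟩ := hcpt.exists_bound_of_continuousOn hcont.continuousOn
  refine tendsto_integral_of_dominated_convergence (fun _ => C)
    (fun n => (continuous_relW_time hW a b x _).aestronglyMeasurable)
    (integrableOn_const (isCompact_Icc.prod isCompact_Icc).measure_lt_top.ne) (fun n => ?_)
    (ae_of_all _ fun p => ?_)
  · refine (ae_restrict_mem (measurableSet_timeSquare R)).mono fun p hp => ?_
    exact hC (u n, p) ⟨mem_insert_of_mem _ (mem_range_self n), hp⟩
  · have h : Continuous fun z : IncrPath d => (z, p) := by fun_prop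
    exact ((hcont.comp h).tendsto y).comp hu

theorem continuous_integral_resample (hμ : IsBrownianIncrementLaw μ)
    (hW : Continuous (Function.uncurry W)) (hK : RelBound W a b K) (lam R : ℝ)
    (f : IncrPath d →ᵇ ℝ) :
    Continuous fun y => ∫ x, f x ∂(resample W μ lam a b (timeSquare R) y) := by
  simp only [integral_resample f.continuous.measurable]
  have hfB : ∀ x, |f x| ≤ ‖f‖ := fun x => f.norm_coe_le_norm x
  have hexp : ∀ x, Continuous fun y =>
      Real.exp (-lam * relEnergy W a b (timeSquare R) x y) := fun x =>
    Real.continuous_exp.comp ((continuous_relEnergy_timeSquare hW a b R x).const_mul (-lam))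
  refine Continuous.div ?_ ?_ fun y => ?_
  · refine continuous_of_dominated (bound := fun x => envelope lam a b K x * ‖f‖)
      (fun y => (integrable_exp_relEnergy_mul hμ hW hK f.continuous.measurable hfB lam _ y).1)
      (fun y => ae_of_all _ fun x => ?_) ((integrable_envelope hμ lam a b K).mul_const _)
      (ae_of_all _ fun x => (hexp x).mul (f.continuous.comp (continuous_splice_right a b x)))
    rw [norm_mul, Real.norm_of_nonneg (Real.exp_pos _).le]
    exact mul_le_mul (exp_relEnergy_le hK lam _ _ _) (f.norm_coe_le_norm _) (norm_nonneg _)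
      (envelope_pos _ _ _ _ _).le
  · refine continuous_of_dominated (bound := envelope lam a b K)
      (fun y => (integrable_exp_relEnergy hμ hW hK lam _ y).1)
      (fun y => ae_of_all _ fun x => ?_) (integrable_envelope hμ lam a b K)
      (ae_of_all _ hexp)
    rw [Real.norm_of_nonneg (Real.exp_pos _).le]
    exact exp_relEnergy_le hK lam _ _ _
  · exact ((integral_envelope_inv_pos hμ lam a b K).trans_le
      (integral_envelope_inv_le hμ hW hK lam _ _)).ne'

theorem relEnergy_window {R : ℝ} {N : ℕ} (ha : -N ≤ a) (hb : b ≤ N) (hR : R ≤ N)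
    (x y : IncrPath d) :
    relEnergy W a b (timeSquare R) x (window N y) = relEnergy W a b (timeSquare R) x y := by
  refine setIntegral_congr_fun (measurableSet_timeSquare R) fun p hp => ?_
  have h1 : p.1 ∈ Icc (-N : ℝ) N := ⟨by linarith [hp.1.1], by linarith [hp.1.2]⟩
  have h2 : p.2 ∈ Icc (-N : ℝ) N := ⟨by linarith [hp.2.1], by linarith [hp.2.2]⟩
  simp only [relW, window, splice_inner_congr ha hb _ y p.1 h1 p.2 h2]

/-- Kernels with energy in a square, applied to functions of a window, depend only on a larger
window of the boundary condition. -/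
theorem integral_resample_window {R : ℝ} {M N : ℕ} (ha : -N ≤ a) (hb : b ≤ N) (hR : R ≤ N)
    (hMN : M ≤ N) {f : IncrPath d → ℝ} (hf : Measurable f) (lam : ℝ) (y : IncrPath d) :
    ∫ x, f (window M x) ∂(resample W μ lam a b (timeSquare R) (window N y)) =
      ∫ x, f (window M x) ∂(resample W μ lam a b (timeSquare R) y) := by
  have hfM : Measurable fun x => f (window M x) := hf.comp (continuous_window M).measurable
  rw [integral_resample hfM, integral_resample hfM]
  have hw : ∀ x, window M (splice a b x (window N y)) = window M (splice a b x y) := by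
    intro x
    have hMN' : (M : ℝ) ≤ N := Nat.cast_le.2 hMN
    have hsub : Icc (-M : ℝ) M ⊆ Icc (-N : ℝ) N := Icc_subset_Icc (by linarith) hMN'
    exact window_congr M fun s hs t ht => splice_inner_congr ha hb x y s (hsub hs) t (hsub ht)
  simp only [relEnergy_window ha hb hR, hw]

end Quasilocal

/-! ### Cluster points are Gibbs measures -/

section Gibbs

variable {W : E d → ℝ → ℝ} {a b : ℝ} {K : ℝ≥0} {μ : Measure (IncrPath d)}

theorem measurable_window (N : ℕ) :
    @Measurable _ _ (incrementField d (Icc (-N : ℝ) N)) _ (window (d := d) N) :=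
  measurable_inner (neg_cast_le N)

/-- A bounded continuous function which depends on a window of the path only is local. -/
theorem exists_localFunction (f : IncrPath d →ᵇ ℝ) (N : ℕ) (h : ∀ x, f (window N x) = f x) :
    ∃ F : LocalFunction d, F.1 = f := by
  refine ⟨⟨f, -((N + 1 : ℕ) : ℝ), ((N + 1 : ℕ) : ℝ), ?_, ?_⟩, rfl⟩
  · push_cast
    linarith [(Nat.cast_nonneg N : (0 : ℝ) ≤ N)]
  · have h1 : (f : IncrPath d → ℝ) = f ∘ window N := funext fun x => (h x).symm
    rw [h1]
    refine f.continuous.measurable.comp ((measurable_window N).mono (incrementField_mono ?_) le_rfl)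
    refine Icc_subset_Icc ?_ ?_ <;> push_cast <;> linarith

theorem integral_bind_resample {ν : Measure (IncrPath d)} [IsProbabilityMeasure ν]
    {π : IncrPath d → Measure (IncrPath d)} (hπ : Measurable π)
    (hP : ∀ y, IsProbabilityMeasure (π y)) (f : IncrPath d →ᵇ ℝ) :
    ∫ x, f x ∂(ν.bind π) = ∫ y, ∫ x, f x ∂(π y) ∂ν := by
  let η : Kernel (IncrPath d) (IncrPath d) := ⟨π, hπ⟩
  have : IsMarkovKernel η := ⟨hP⟩
  have h := Kernel.integral_comp (κ := Kernel.const Unit ν) (η := η) (a := ()) (f := f)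
    (f.integrable _)
  rw [Kernel.comp_apply, Kernel.const_apply] at h
  exact h

theorem abs_integral_sub_le {ρ : Measure (IncrPath d)} [IsProbabilityMeasure ρ]
    {f g : IncrPath d → ℝ} (hf : Integrable f ρ) (hg : Integrable g ρ) {ε : ℝ}
    (h : ∀ x, |f x - g x| ≤ ε) : |∫ x, f x ∂ρ - ∫ x, g x ∂ρ| ≤ ε := by
  rw [← integral_sub hf hg]
  simpa using norm_integral_le_of_norm_le_const (μ := ρ) (f := fun x => f x - g x) (C := ε)
    (ae_of_all _ fun x => h x)

theorem integrable_integral_kernel {ν : Measure (IncrPath d)} [IsProbabilityMeasure ν]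
    {π : IncrPath d → Measure (IncrPath d)} (hπ : Measurable π)
    (hP : ∀ y, IsProbabilityMeasure (π y)) (f : IncrPath d →ᵇ ℝ) :
    Integrable (fun y => ∫ x, f x ∂(π y)) ν := by
  let η : Kernel (IncrPath d) (IncrPath d) := ⟨π, hπ⟩
  have : IsMarkovKernel η := ⟨hP⟩
  have h : StronglyMeasurable fun y => ∫ x, f x ∂(η y) :=
    f.continuous.stronglyMeasurable.integral_kernel
  refine Integrable.of_bound h.aestronglyMeasurable ‖f‖ (ae_of_all _ fun y => ?_)
  have := hP y
  have := norm_integral_le_of_norm_le_const (μ := π y) (f := f) (C := ‖f‖)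
    (ae_of_all _ fun x => f.norm_coe_le_norm x)
  simpa using this

/-- A cluster point of the finite-volume measures is invariant under the specification, when
tested against functions of a window. -/
theorem integral_window_eq_of_mapClusterPt (hμ : IsBrownianIncrementLaw μ)
    (hW : Continuous (Function.uncurry W)) (hH1 : H1 W)
    (hH2 : H2 W) (hH1' : H1 (reflect W)) (hH2' : H2 (reflect W)) (hK : RelBound W a b K)
    (hab : a ≤ b) (lam : ℝ) {ν : Measure (IncrPath d)} [IsProbabilityMeasure ν]
    (hν : @MapClusterPt _ (localTopology d) _ ν atTop fun T : ℝ => finiteVolume W μ lam T)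
    (f : IncrPath d →ᵇ ℝ) (M : ℕ) :
    ∫ x, f (window M x) ∂ν = ∫ y, ∫ x, f (window M x) ∂(resample W μ lam a b univ y) ∂ν := by
  set F : IncrPath d →ᵇ ℝ := f.compContinuous ⟨window M, continuous_window M⟩ with hF
  have hFx : ∀ x, F x = f (window M x) := fun x => rfl
  have hFB : ∀ x, |F x| ≤ ‖F‖ := fun x => F.norm_coe_le_norm x
  have hP := fun (S : Set (ℝ × ℝ)) y => isProbabilityMeasure_resample hμ hW hK lam S y
  have hπ := fun S : Set (ℝ × ℝ) => measurable_resample (a := a) (b := b) hμ hW lam S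
  simp only [← hFx]
  refine eq_of_abs_sub_le_all fun ε hε => ?_
  obtain ⟨R, hR⟩ := exists_abs_integral_resample_sub_le hμ hW hH1 hH2 hH1' hH2' hK hab lam
    F.continuous.measurable hFB (by positivity : 0 < ε / 5)
  -- the local approximation of the kernel applied to `F`
  let G : IncrPath d →ᵇ ℝ := BoundedContinuousFunction.ofNormedAddCommGroup
    (fun y => ∫ x, F x ∂(resample W μ lam a b (timeSquare R) y))
    (continuous_integral_resample hμ hW hK lam R F) ‖F‖ fun y => by
      have := hP (timeSquare R) y
      have := norm_integral_le_of_norm_le_const (μ := resample W μ lam a b (timeSquare R) y)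
        (f := F) (C := ‖F‖) (ae_of_all _ fun x => F.norm_coe_le_norm x)
      simpa using this
  have hGy : ∀ y, G y = ∫ x, F x ∂(resample W μ lam a b (timeSquare R) y) := fun y => rfl
  obtain ⟨N, hN⟩ := exists_nat_ge (max (max |a| |b|) (max R M))
  have hNa : -(N : ℝ) ≤ a :=
    (abs_le.1 (((le_max_left _ _).trans (le_max_left _ _)).trans hN)).1
  have hNb : b ≤ N := (abs_le.1 (((le_max_right _ _).trans (le_max_left _ _)).trans hN)).2
  have hNR : R ≤ N := ((le_max_left _ _).trans (le_max_right _ _)).trans hN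
  have hNM : M ≤ N := Nat.cast_le.1 (((le_max_right _ _).trans (le_max_right _ _)).trans hN)
  obtain ⟨F', hF'⟩ := exists_localFunction F M fun x => by
    rw [hFx, hFx]
    exact congrArg f (window_congr M fun s hs t ht => inc_window M x hs ht)
  obtain ⟨G', hG'⟩ := exists_localFunction G N fun y =>
    integral_resample_window hNa hNb hNR hNM f.continuous.measurable lam y
  -- a large volume in which the integrals of both local functions are close to those under `ν`
  obtain ⟨T, hTR, hT0, hTF, hTG⟩ : ∃ T : ℝ, R ≤ T ∧ 0 ≤ T ∧
      |∫ x, F x ∂(finiteVolume W μ lam T) - ∫ x, F x ∂ν| < ε / 5 ∧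
      |∫ x, G x ∂(finiteVolume W μ lam T) - ∫ x, G x ∂ν| < ε / 5 := by
    let _ : TopologicalSpace (Measure (IncrPath d)) := localTopology d
    have hind : Continuous fun (ρ : Measure (IncrPath d)) (g : LocalFunction d) => ∫ x, g.1 x ∂ρ :=
      continuous_induced_dom
    have hcont : ∀ g : LocalFunction d,
        Continuous fun ρ : Measure (IncrPath d) => ∫ x, g.1 x ∂ρ := fun g =>
      continuous_pi_iff.1 hind g
    have hnhds : ∀ g : LocalFunction d, ∀ᶠ ρ : Measure (IncrPath d) in nhds ν,
        |∫ x, g.1 x ∂ρ - ∫ x, g.1 x ∂ν| < ε / 5 := fun g =>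
      (hcont g).tendsto ν (Metric.ball_mem_nhds _ (by positivity))
    have hfreq := (mapClusterPt_iff_frequently.1 hν) _ ((hnhds F').and (hnhds G'))
    obtain ⟨T, hT, hTR⟩ := (hfreq.and_eventually (eventually_ge_atTop (max R 0))).exists
    rw [← hF', ← hG']
    exact ⟨T, (le_max_left _ _).trans hTR, (le_max_right _ _).trans hTR, hT.1, hT.2⟩
  have := isProbabilityMeasure_finiteVolume hμ hW hH1 hH1' lam hT0
  have hinv : ∫ x, F x ∂(finiteVolume W μ lam T) =
      ∫ y, ∫ x, F x ∂(resample W μ lam a b (timeSquare T) y) ∂(finiteVolume W μ lam T) := by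
    conv_lhs => rw [← bind_resample_finiteVolume hμ hW hK hab lam hT0]
    exact integral_bind_resample (hπ _) (hP _) F
  have hTG' : |∫ x, F x ∂(finiteVolume W μ lam T) - ∫ x, G x ∂(finiteVolume W μ lam T)| ≤
      ε / 5 + ε / 5 := by
    rw [hinv]
    refine abs_integral_sub_le (integrable_integral_kernel (hπ _) (hP _) F) (G.integrable _)
      fun y => ?_
    rw [hGy]
    refine (abs_sub_le _ (∫ x, F x ∂(resample W μ lam a b univ y)) _).trans
      (add_le_add (hR T hTR y) ?_)
    rw [abs_sub_comm]
    exact hR R le_rfl y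
  have hνG : |∫ x, G x ∂ν - ∫ y, ∫ x, F x ∂(resample W μ lam a b univ y) ∂ν| ≤ ε / 5 :=
    abs_integral_sub_le (G.integrable _) (integrable_integral_kernel (hπ _) (hP _) F)
      fun y => hR R le_rfl y
  rw [abs_lt] at hTF hTG
  rw [abs_le] at hTG' hνG ⊢
  constructor <;> linarith [hTF.1, hTF.2, hTG.1, hTG.2, hTG'.1, hTG'.2, hνG.1, hνG.2]

/-- A cluster point of the finite-volume measures is invariant under the specification. -/
theorem bind_resample_eq_of_mapClusterPt (hμ : IsBrownianIncrementLaw μ)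
    (hW : Continuous (Function.uncurry W)) (hH1 : H1 W)
    (hH2 : H2 W) (hH1' : H1 (reflect W)) (hH2' : H2 (reflect W)) (hK : RelBound W a b K)
    (hab : a ≤ b) (lam : ℝ) {ν : Measure (IncrPath d)} [IsProbabilityMeasure ν]
    (hν : @MapClusterPt _ (localTopology d) _ ν atTop fun T : ℝ => finiteVolume W μ lam T) :
    ν.bind (resample W μ lam a b univ) = ν := by
  have hP := fun y => isProbabilityMeasure_resample hμ hW hK lam univ y
  have hπ := measurable_resample (a := a) (b := b) hμ hW lam univ
  have hbind : IsProbabilityMeasure (ν.bind (resample W μ lam a b univ)) := by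
    refine ⟨?_⟩
    rw [Measure.bind_apply MeasurableSet.univ hπ.aemeasurable]
    simp
  refine ext_of_forall_integral_eq_of_IsFiniteMeasure fun f => ?_
  have hlim : ∀ ρ : Measure (IncrPath d), IsProbabilityMeasure ρ →
      Tendsto (fun M : ℕ => ∫ x, f (window M x) ∂ρ) atTop (nhds (∫ x, f x ∂ρ)) := by
    intro ρ hρ
    refine tendsto_integral_of_dominated_convergence (fun _ => ‖f‖)
      (fun M => (f.continuous.comp (continuous_window M)).aestronglyMeasurable)
      (integrable_const _) (fun M => ae_of_all _ fun x => f.norm_coe_le_norm _)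
      (ae_of_all _ fun x => ?_)
    exact (f.continuous.tendsto x).comp (tendsto_window x)
  refine tendsto_nhds_unique (hlim _ hbind) ((hlim ν inferInstance).congr fun M => ?_)
  rw [integral_window_eq_of_mapClusterPt hμ hW hH1 hH2 hH1' hH2' hK hab lam hν f M]
  exact (integral_bind_resample hπ hP (f.compContinuous ⟨window M, continuous_window M⟩)).symm

/-- An invariant measure of the kernels is a Gibbs measure, since the kernels do not change the
path outside `[a,b]`. -/
theorem condExp_ae_eq_of_bind_eq (hμ : IsBrownianIncrementLaw μ)
    (hW : Continuous (Function.uncurry W)) (hK : RelBound W a b K) (hab : a ≤ b) (lam : ℝ)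
    {ν : Measure (IncrPath d)} [IsProbabilityMeasure ν]
    (hν : ν.bind (resample W μ lam a b univ) = ν) {A : Set (IncrPath d)}
    (hA : MeasurableSet A) :
    (fun y => (resample W μ lam a b univ y).real A)
      =ᵐ[ν] ν[A.indicator (fun _ => (1 : ℝ)) | incrementField d (Icc a b)ᶜ] := by
  set π := resample W μ lam a b univ with hπdef
  have hP : ∀ y, IsProbabilityMeasure (π y) := isProbabilityMeasure_resample hμ hW hK lam univ
  have hπ : Measurable π := measurable_resample hμ hW lam univ
  have hmA : Measurable fun y => (π y).real A :=
    ((Measure.measurable_coe hA).comp hπ).ennreal_toReal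
  have hint : Integrable (fun y => (π y).real A) ν := by
    refine Integrable.of_bound hmA.aestronglyMeasurable 1 (ae_of_all _ fun y => ?_)
    rw [Real.norm_of_nonneg measureReal_nonneg]
    exact measureReal_le_one
  refine ae_eq_condExp_of_forall_setIntegral_eq (incrementField_le _)
    ((integrable_const (1 : ℝ)).indicator hA) (fun B _ _ => hint.integrableOn) (fun B hB _ => ?_) ?_
  · have hB' : MeasurableSet B := incrementField_le _ B hB
    rw [integral_indicator_const _ hA, smul_eq_mul, mul_one, measureReal_restrict_apply hA]
    have hprop : ∀ y, π y (A ∩ B) = B.indicator (fun y => π y A) y := by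
      intro y
      have hs := (continuous_splice_left a b y).measurable
      by_cases hy : y ∈ B
      · rw [indicator_of_mem hy, hπdef, resample, Measure.map_apply hs (hA.inter hB'),
          Measure.map_apply hs hA]
        congr 1
        ext x
        simp [splice_mem_iff hab hB, hy]
      · rw [indicator_of_notMem hy, hπdef, resample, Measure.map_apply hs (hA.inter hB')]
        have he : (fun x => splice a b x y) ⁻¹' (A ∩ B) = ∅ := by
          ext x
          simp [splice_mem_iff hab hB, hy]
        rw [he, measure_empty]
    have h1 : ν (A ∩ B) = ∫⁻ y in B, π y A ∂ν := by
      conv_lhs => rw [← hν]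
      rw [Measure.bind_apply (hA.inter hB') hπ.aemeasurable, ← lintegral_indicator hB']
      exact lintegral_congr hprop
    rw [measureReal_def, h1]
    exact integral_toReal ((Measure.measurable_coe hA).comp hπ).aemeasurable
      (ae_of_all _ fun y => measure_lt_top _ _)
  · have h : (fun y => (π y).real A) = (fun y => (π y).real A) ∘ fun y => splice a b 0 y := by
      funext y
      simp only [Function.comp_apply, hπdef, resample_splice hab]
    rw [h]
    exact (Measurable.stronglyMeasurable
      (hmA.comp (measurable_outer a b))).aestronglyMeasurable

end Gibbs

end BrownianIncrements

open BrownianIncrements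
theorem mainTheorem2 {d : ℕ} (W : E d → ℝ → ℝ) (hW : Continuous (Function.uncurry W))
    (hH1 : H1 W) (hH2 : H2 W) (hH1' : H1 (reflect W)) (hH2' : H2 (reflect W))
    (μ : Measure (IncrPath d)) (hμ : IsBrownianIncrementLaw μ) (lam : ℝ) :
    SpecWellDefined W μ lam ∧
    (∀ T : ℝ, 1 ≤ T → IsProbabilityMeasure (finiteVolume W μ lam T)) ∧
    IsTightMeasureSet (finiteVolume W μ lam '' Ici 1) ∧
    ∀ ν : Measure (IncrPath d), IsProbabilityMeasure ν →
      @MapClusterPt _ (localTopology d) _ ν atTop (fun T : ℝ => finiteVolume W μ lam T) →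
      IsGibbs W μ lam ν := by
  refine ⟨fun a b hab y => ?_, fun T hT => ?_, ?_, fun ν hν hcl => ⟨hν, fun a b hab A hA => ?_⟩⟩
  · obtain ⟨K, hK⟩ := exists_lintegral_relW_le hW hH1 hH2 hH1' hH2' hab.le
    refine ⟨fun x => (integrable_relW hW hK x y).integrableOn, ?_⟩
    rw [spec_eq_resample hW hK hab.le]
    exact isProbabilityMeasure_resample hμ hW hK lam univ y
  · exact isProbabilityMeasure_finiteVolume hμ hW hH1 hH1' lam (zero_le_one.trans hT)
  · exact isTightMeasureSet_finiteVolume hμ hW hH1 hH2 hH1' hH2' lam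
  · obtain ⟨K, hK⟩ := exists_lintegral_relW_le hW hH1 hH2 hH1' hH2' hab.le
    simp only [spec_eq_resample hW hK hab.le]
    exact condExp_ae_eq_of_bind_eq hμ hW hK hab.le lam
      (bind_resample_eq_of_mapClusterPt hμ hW hH1 hH2 hH1' hH2' hK hab.le lam hcl) hA
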